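/- Let $\mathbb K$ be an algebraically closed field of characteristic $p>0$, let $G$ be a connected reductive algebraic group over $\mathbb K$, $T\subseteq B$ a maximal torus and a Borel subgroup of $G$, $X=X(T)$ the character group, $\mathfrak g=\mathrm{Lie}(G)$, $\mathfrak h=\mathrm{Lie}(T)$, $\mathfrak b=\mathrm{Lie}(B)$, $R$, $R^+$ and $\Pi$ the roots, the positive roots (those of $\mathfrak b$) and the simple roots. For $\mu\in X$ let $d\mu\in\mathfrak h^*$ be its differential. Choose root vectors $e_\alpha\in\mathfrak g_\alpha$ ($\alpha\in R$) that together with a basis of $\mathfrak h$ form a basis of $\mathfrak g$, and put $h_\alpha=[e_\alpha,e_{-\alpha}]\in\mathfrak h$. Let $I\subseteq\Pi$ and let $\chi\in\mathfrak g^*$ be in standard Levi form: $\chi(\mathfrak b)=0$ and, for $\alpha\in R^+$, $\chi(e_{-\alpha})=1$ if $\alpha\in I$ and $0$ otherwise. Put $U_\chi=U(\mathfrak g)/\langle e_\alpha^p-\chi(e_\alpha)^p\mid\alpha\in R\rangle$, graded by $X/\mathbb ZI$ with $e_\alpha$ in degree $\alpha+\mathbb ZI$ and $\mathfrak h$ in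 degree $0$; let $U^0=U(\mathfrak h)$, let $U^0U^+\subseteq U_\chi$ be the subalgebra generated by $\mathfrak h$ and the $e_\alpha$, $\alpha\in R^+$, and for $\mu\in X$ let $\widetilde\mu$ be the automorphism of $U^0$ with $\widetilde\mu(h)=h+d\mu(h)$ for $h\in\mathfrak h$. For a commutative Noetherian $U^0$-algebra $A$ with structure map $\pi:U^0\to A$ let $\mathcal C_A$ be the category whose objects are the $U_\chi\otimes_{\mathbb K}A$-modules $M$ with a decomposition into $A$-submodules $M=\bigoplus_{c\in X/\mathbb ZI}M_c$, $M_c=\bigoplus_{d\mu:\ \mu\in c+pX}M_c^{d\mu}$, such that only finitely many $M_c$ are nonzero, each $M_c$ is finitely generated over $A$, $(U_\chi)_bM_c\subseteq M_{b+c}$, $sm=m\,\pi(\widetilde\mu(s))$ for $s\in U^0$, $m\in M_c^{d\mu}$, and $e_\alpha M_c^{d\mu}\subseteq M_{c+\alpha}^{d(\mu+\alpha)}$ for $\alpha\in R$; morphisms are the homomorphisms of $U_\chi\otimes A$-modules that map each $M_c^{d\mu}$ into $N_c^{d\mu}$. For $\lambda\in X$ let $Z_{A,\chi}(\lambda)=U_\chi\otimes_{U^0U^+}A^\lambda\in\mathcal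 C_A$ be the baby Verma module, where $A^\lambda=A$, on which $s\in U^0$ acts as $\pi(\widetilde\lambda(s))$ and each $e_\alpha$ ($\alpha\in R^+$) as $0$, placed in degree $(\lambda+\mathbb ZI,d\lambda)$. Two elements of $X$ lie in the same block over $A$ if they are equivalent under the smallest equivalence relation on $X$ that relates $\lambda$ and $\mu$ whenever $\mathrm{Hom}_{\mathcal C_A}(Z_{A,\chi}(\lambda),Z_{A,\chi}(\mu))\neq0$ or $\mathrm{Ext}^1_{\mathcal C_A}(Z_{A,\chi}(\lambda),Z_{A,\chi}(\mu))\neq0$. Theorem. Let $A$ be a commutative, Noetherian, local $U^0$-algebra with structure map $\pi:U^0\to A$ and residue field $F$, regarded as a $U^0$-algebra via $U^0\to A\to F$. Suppose that $\pi(h_\alpha)=0$ for all $\alpha\in R$. Then $\lambda,\mu\in X$ lie in the same block over $A$ if and only if they lie in the same block over $F$. -/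

import Mathlib

open scoped TensorProduct

universe u v

attribute [local instance 100] LieRing.ofAssociativeRing

/-! ### Linear algebraic groups as Zariski closed subgroups of `GL_n(K)` -/

namespace LinAlg

variable {K : Type u} [Field K] {n : ℕ}

/-- Polynomials in the entries of a matrix (left summand) and in the entries of its inverse
(right summand); they restrict to all the regular functions on `GL_n`. -/
abbrev Coord (K : Type u) [Field K] (n : ℕ) : Type u :=
  MvPolynomial ((Fin n × Fin n) ⊕ (Fin n × Fin n)) K

/-- The value of a regular function at `g`. -/
noncomputable def evalAt (g : GL (Fin n) K) : Coord K n →ₐ[K] K :=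
  MvPolynomial.aeval (Sum.elim (fun ij => (g : Matrix (Fin n) (Fin n) K) ij.1 ij.2)
    (fun ij => ((g⁻¹ : GL (Fin n) K) : Matrix (Fin n) (Fin n) K) ij.1 ij.2))

def IsZariskiClosed (S : Set (GL (Fin n) K)) : Prop :=
  ∃ P : Set (Coord K n), S = {g | ∀ f ∈ P, evalAt g f = 0}

/-- Connectedness in the Zariski topology. -/
def IsZariskiConnected (S : Set (GL (Fin n) K)) : Prop :=
  S.Nonempty ∧ ∀ Z₁ Z₂ : Set (GL (Fin n) K), IsZariskiClosed Z₁ → IsZariskiClosed Z₂ →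
    S ⊆ Z₁ ∪ Z₂ → S ∩ (Z₁ ∩ Z₂) = ∅ → S ⊆ Z₁ ∨ S ⊆ Z₂

/-- Closed connected subgroups of `GL_n(K)`. -/
def IsConnectedAlgGroup (H : Subgroup (GL (Fin n) K)) : Prop :=
  IsZariskiClosed (H : Set (GL (Fin n) K)) ∧ IsZariskiConnected (H : Set (GL (Fin n) K))

def IsUnipotent (H : Subgroup (GL (Fin n) K)) : Prop :=
  ∀ g ∈ H, IsNilpotent ((g : Matrix (Fin n) (Fin n) K) - 1)

/-- Connected reductive: every closed connected normal unipotent subgroup is trivial. -/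
def IsReductive (G : Subgroup (GL (Fin n) K)) : Prop :=
  IsConnectedAlgGroup G ∧ ∀ N : Subgroup (GL (Fin n) K), N ≤ G → IsConnectedAlgGroup N →
    (∀ g ∈ G, ∀ x ∈ N, g * x * g⁻¹ ∈ N) → IsUnipotent N → N = ⊥

/-- Tori: closed connected subgroups that can be diagonalized. -/
def IsTorus (T : Subgroup (GL (Fin n) K)) : Prop :=
  IsConnectedAlgGroup T ∧ ∃ g : GL (Fin n) K, ∀ t ∈ T,
    ((g * t * g⁻¹ : GL (Fin n) K) : Matrix (Fin n) (Fin n) K).IsDiag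

def IsMaximalTorus (G T : Subgroup (GL (Fin n) K)) : Prop :=
  Maximal (fun S : Subgroup (GL (Fin n) K) => S ≤ G ∧ IsTorus S) T

def IsBorel (G B : Subgroup (GL (Fin n) K)) : Prop :=
  Maximal (fun S : Subgroup (GL (Fin n) K) =>
    S ≤ G ∧ IsConnectedAlgGroup S ∧ Group.IsSolvable S) B

/-! ### The Lie algebra -/

/-- The left invariant derivation of the coordinate ring of `GL_n` attached to a matrix `x`:
it sends the generic matrix `g` to `g x`, hence `g⁻¹` to `-x g⁻¹`. -/
noncomputable def invDer (x : Matrix (Fin n) (Fin n) K) :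
    Derivation K (Coord K n) (Coord K n) :=
  MvPolynomial.mkDerivation K (Sum.elim
    (fun ij => ∑ k, x k ij.2 • MvPolynomial.X (Sum.inl (ij.1, k)))
    (fun ij => -∑ k, x ij.1 k • MvPolynomial.X (Sum.inr (k, ij.2))))

/-- The ideal of all regular functions that vanish on `H`. -/
noncomputable def vanishing (H : Subgroup (GL (Fin n) K)) : Ideal (Coord K n) :=
  ⨅ g ∈ H, RingHom.ker (evalAt g)

theorem mem_vanishing {H : Subgroup (GL (Fin n) K)} {f : Coord K n} :
    f ∈ vanishing H ↔ ∀ g ∈ H, evalAt g f = 0 := by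
  simp [vanishing, Submodule.mem_iInf, RingHom.mem_ker]

theorem invDer_add (x y : Matrix (Fin n) (Fin n) K) : invDer (x + y) = invDer x + invDer y := by
  refine MvPolynomial.derivation_ext ?_
  rintro (ij | ij)
  · simp [invDer, MvPolynomial.mkDerivation_X, add_smul, Finset.sum_add_distrib]
  · simp only [invDer, Derivation.add_apply, MvPolynomial.mkDerivation_X, Sum.elim_inr,
      Matrix.add_apply, add_smul, Finset.sum_add_distrib, neg_add]

theorem invDer_smul (c : K) (x : Matrix (Fin n) (Fin n) K) : invDer (c • x) = c • invDer x := by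
  refine MvPolynomial.derivation_ext ?_
  rintro (ij | ij) <;>
  simp [invDer, MvPolynomial.mkDerivation_X, mul_smul, Finset.smul_sum]

theorem invDer_lie (x y : Matrix (Fin n) (Fin n) K) : invDer ⁅x, y⁆ = ⁅invDer x, invDer y⁆ := by
  refine MvPolynomial.derivation_ext ?_
  rintro (ij | ij)
  · simp only [Derivation.commutator_apply, invDer, MvPolynomial.mkDerivation_X, Sum.elim_inl,
      map_sum, Derivation.map_smul, Ring.lie_def, Matrix.sub_apply, Matrix.mul_apply, sub_smul,
      Finset.sum_sub_distrib, Finset.sum_smul, Finset.smul_sum, mul_smul]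
    rw [Finset.sum_comm]
    nth_rw 2 [Finset.sum_comm]
    simp only [smul_smul, mul_comm]
  · simp only [Derivation.commutator_apply, invDer, MvPolynomial.mkDerivation_X, Sum.elim_inr,
      map_sum, map_neg, Derivation.map_smul, Ring.lie_def, Matrix.sub_apply, Matrix.mul_apply,
      sub_smul, Finset.sum_sub_distrib, Finset.sum_smul, Finset.smul_sum, mul_smul, smul_neg,
      Finset.sum_neg_distrib, neg_neg]
    rw [Finset.sum_comm]
    nth_rw 2 [Finset.sum_comm]
    simp only [neg_sub]

/-- Left translation of regular functions. -/
noncomputable def translate (g : GL (Fin n) K) : Coord K n →ₐ[K] Coord K n :=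
  MvPolynomial.aeval (Sum.elim
    (fun ij => ∑ k, (g : Matrix (Fin n) (Fin n) K) ij.1 k • MvPolynomial.X (Sum.inl (k, ij.2)))
    (fun ij => ∑ k, ((g⁻¹ : GL (Fin n) K) : Matrix (Fin n) (Fin n) K) k ij.2 •
      MvPolynomial.X (Sum.inr (ij.1, k))))

theorem evalAt_translate (g h : GL (Fin n) K) (f : Coord K n) :
    evalAt h (translate g f) = evalAt (g * h) f := by
  have : (evalAt h).comp (translate g) = evalAt (g * h) := by
    refine MvPolynomial.algHom_ext ?_
    rintro (ij | ij)
    · simp [evalAt, translate, Matrix.mul_apply]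
    · simp [evalAt, translate, Matrix.mul_apply, mul_comm]
  exact DFunLike.congr_fun this f

theorem invDer_translate (g : GL (Fin n) K) (x : Matrix (Fin n) (Fin n) K) (f : Coord K n) :
    invDer x (translate g f) = translate g (invDer x f) := by
  induction f using MvPolynomial.induction_on with
  | C a =>
    rw [show (MvPolynomial.C a : Coord K n) = algebraMap K _ a from rfl]
    simp
  | add p q hp hq => simp [hp, hq]
  | mul_X p i hp =>
    have key : invDer x (translate g (MvPolynomial.X i)) =
        translate g (invDer x (MvPolynomial.X i)) := by
      rcases i with ij | ij
      · simp only [invDer, translate, MvPolynomial.aeval_X, MvPolynomial.mkDerivation_X,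
          Sum.elim_inl, map_sum, Derivation.map_smul, map_smul, Finset.smul_sum]
        rw [Finset.sum_comm]
        simp only [smul_smul, mul_comm]
      · simp only [invDer, translate, MvPolynomial.aeval_X, MvPolynomial.mkDerivation_X,
          Sum.elim_inr, map_sum, map_neg, Derivation.map_smul, map_smul, Finset.smul_sum,
          smul_neg, Finset.sum_neg_distrib]
        rw [Finset.sum_comm]
        simp only [smul_smul, mul_comm]
    simp [hp, key]

theorem invDer_mem_vanishing {H : Subgroup (GL (Fin n) K)} {x : Matrix (Fin n) (Fin n) K}
    (hx : ∀ f ∈ vanishing H, evalAt 1 (invDer x f) = 0) {f : Coord K n} (hf : f ∈ vanishing H) :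
    invDer x f ∈ vanishing H := by
  rw [mem_vanishing] at hf ⊢
  intro g hg
  have h1 : translate g f ∈ vanishing H := by
    rw [mem_vanishing]
    intro h hh
    rw [evalAt_translate]
    exact hf _ (H.mul_mem hg hh)
  have h2 := hx _ h1
  rwa [invDer_translate, evalAt_translate, mul_one] at h2

/-- The Lie algebra of `H`: the tangent space at the identity, inside `𝔤𝔩_n`. -/
noncomputable def lieAlg (H : Subgroup (GL (Fin n) K)) :
    LieSubalgebra K (Matrix (Fin n) (Fin n) K) where
  carrier := {x | ∀ f ∈ vanishing H, evalAt 1 (invDer x f) = 0}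
  add_mem' := by
    intro x y hx hy f hf
    simp [invDer_add, hx f hf, hy f hf]
  zero_mem' := by
    intro f _
    have : invDer (0 : Matrix (Fin n) (Fin n) K) = 0 := by
      simpa using invDer_smul (0 : K) (0 : Matrix (Fin n) (Fin n) K)
    simp [this]
  smul_mem' := by
    intro c x hx f hf
    simp [invDer_smul, hx f hf]
  lie_mem' := by
    intro x y hx hy f hf
    rw [invDer_lie, Derivation.commutator_apply, map_sub, hx _ (invDer_mem_vanishing hy hf),
      hy _ (invDer_mem_vanishing hx hf), sub_zero]

theorem mem_lieAlg {H : Subgroup (GL (Fin n) K)} {x : Matrix (Fin n) (Fin n) K} :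
    x ∈ lieAlg H ↔ ∀ f ∈ vanishing H, evalAt 1 (invDer x f) = 0 := Iff.rfl

/-! ### Characters and roots -/

/-- The algebraic characters `H → 𝔾_m`. -/
def charGroup (H : Subgroup (GL (Fin n) K)) : Subgroup (H →* Kˣ) where
  carrier := {c | ∃ f : Coord K n, ∀ t : H, (c t : K) = evalAt (t : GL (Fin n) K) f}
  mul_mem' := by
    rintro a b ⟨f, hf⟩ ⟨g, hg⟩
    exact ⟨f * g, fun t => by simp [hf, hg]⟩
  one_mem' := ⟨1, fun t => by simp⟩
  inv_mem' := by
    rintro a ⟨f, hf⟩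
    refine ⟨MvPolynomial.rename Sum.swap f, fun t => ?_⟩
    have h1 : evalAt (t : GL (Fin n) K) (MvPolynomial.rename Sum.swap f) =
        evalAt ((t⁻¹ : H) : GL (Fin n) K) f := by
      rw [evalAt, evalAt, MvPolynomial.aeval_rename]
      congr 2
      funext i
      rcases i with ij | ij <;> simp
    rw [h1, ← hf, map_inv]
    rfl

/-- The character group `X(H)`, written additively. -/
abbrev Chars (H : Subgroup (GL (Fin n) K)) : Type u := Additive (charGroup H)

/-- The value of the character `c` at `t`. -/
def Chars.val {H : Subgroup (GL (Fin n) K)} (c : Chars H) (t : H) : K :=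
  ((c.toMul : H →* Kˣ) t : K)

theorem Chars.exists_poly {H : Subgroup (GL (Fin n) K)} (c : Chars H) :
    ∃ f : Coord K n, ∀ t : H, c.val t = evalAt (t : GL (Fin n) K) f := c.toMul.2

theorem Chars.val_add {H : Subgroup (GL (Fin n) K)} (c d : Chars H) (t : H) :
    (c + d).val t = c.val t * d.val t := by
  simp [Chars.val]

theorem Chars.val_zero {H : Subgroup (GL (Fin n) K)} (t : H) : (0 : Chars H).val t = 1 := by
  simp [Chars.val]

theorem Chars.val_one {H : Subgroup (GL (Fin n) K)} (c : Chars H) : c.val 1 = 1 := by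
  simp [Chars.val]

theorem Chars.ext_val {H : Subgroup (GL (Fin n) K)} {c d : Chars H}
    (h : ∀ t, c.val t = d.val t) : c = d := by
  apply Additive.toMul.injective
  apply Subtype.ext
  ext t
  exact h t

/-- The derivative at the identity, in the direction `x`, of a regular function that
represents the character `c`. -/
noncomputable def diffFun {H : Subgroup (GL (Fin n) K)} (c : Chars H) (x : lieAlg H) : K :=
  evalAt 1 (invDer (x : Matrix (Fin n) (Fin n) K) c.exists_poly.choose)

theorem diffFun_eq {H : Subgroup (GL (Fin n) K)} (c : Chars H) (x : lieAlg H) (f : Coord K n)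
    (hf : ∀ t : H, c.val t = evalAt (t : GL (Fin n) K) f) :
    diffFun c x = evalAt 1 (invDer (x : Matrix (Fin n) (Fin n) K) f) := by
  have h : c.exists_poly.choose - f ∈ vanishing H := by
    rw [mem_vanishing]
    intro g hg
    rw [map_sub, ← hf ⟨g, hg⟩, ← c.exists_poly.choose_spec ⟨g, hg⟩, sub_self]
  have h2 := x.2 _ h
  rw [map_sub, map_sub, sub_eq_zero] at h2
  exact h2

theorem diffFun_add {H : Subgroup (GL (Fin n) K)} (c d : Chars H) (x : lieAlg H) :
    diffFun (c + d) x = diffFun c x + diffFun d x := by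
  obtain ⟨f, hf⟩ := c.exists_poly
  obtain ⟨g, hg⟩ := d.exists_poly
  have h1 := diffFun_eq (c + d) x (f * g)
    (fun t => by rw [Chars.val_add, hf, hg, map_mul])
  have hf1 : evalAt (1 : GL (Fin n) K) f = 1 := by
    rw [← Chars.val_one c]
    exact (hf 1).symm
  have hg1 : evalAt (1 : GL (Fin n) K) g = 1 := by
    rw [← Chars.val_one d]
    exact (hg 1).symm
  rw [h1, diffFun_eq c x f hf, diffFun_eq d x g hg, Derivation.leibniz, map_add, smul_eq_mul,
    smul_eq_mul, map_mul, map_mul, hf1, hg1, one_mul, one_mul, add_comm]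

/-- The differential `dc : Lie(H) → K` of a character `c`. -/
noncomputable def diffLin {H : Subgroup (GL (Fin n) K)} (c : Chars H) :
    Module.Dual K (lieAlg H) where
  toFun := diffFun c
  map_add' x y := by
    rw [diffFun, AddMemClass.coe_add, invDer_add, Derivation.add_apply, map_add]
    rfl
  map_smul' r x := by
    rw [diffFun, SetLike.val_smul, invDer_smul, Derivation.smul_apply, map_smul]
    rfl

/-- The homomorphism `X(H) → Lie(H)^*`, `c ↦ dc`. -/
noncomputable def diff (H : Subgroup (GL (Fin n) K)) :
    Chars H →+ Module.Dual K (lieAlg H) :=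
  AddMonoidHom.mk' diffLin fun c d => LinearMap.ext fun x => diffFun_add c d x

/-- The weight space of weight `c` for the adjoint action of `T` on `Lie(H)`. -/
def weightSpace (H T : Subgroup (GL (Fin n) K)) (c : Chars T) : Submodule K (lieAlg H) where
  carrier := {x | ∀ t : T, ((t : GL (Fin n) K) : Matrix (Fin n) (Fin n) K) * x *
    (((t : GL (Fin n) K)⁻¹ : GL (Fin n) K) : Matrix (Fin n) (Fin n) K) =
      c.val t • (x : Matrix (Fin n) (Fin n) K)}
  add_mem' := by
    intro x y hx hy t
    rw [AddMemClass.coe_add, mul_add, add_mul, smul_add, hx t, hy t]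
  zero_mem' := by
    intro t
    simp
  smul_mem' := by
    intro r x hx t
    rw [SetLike.val_smul, Matrix.mul_smul, Matrix.smul_mul, hx t, smul_comm]

/-- The nonzero weights of `T` on `Lie(H)`. -/
def roots (H T : Subgroup (GL (Fin n) K)) : Set (Chars T) :=
  {c | c ≠ 0 ∧ weightSpace H T c ≠ ⊥}

/-- The simple roots of the positive system that is attached to the Borel subgroup `B`:
the elements of the positive system that are not sums of two elements of it. -/
def simpleRoots (B T : Subgroup (GL (Fin n) K)) : Set (Chars T) :=
  {c | c ∈ roots B T ∧ ¬ ∃ a ∈ roots B T, ∃ b ∈ roots B T, c = a + b}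

/-- `Lie(T)` as a subalgebra of `Lie(H)`. -/
noncomputable def cartan (H T : Subgroup (GL (Fin n) K)) : LieSubalgebra K (lieAlg H) :=
  (lieAlg T).comap (lieAlg H).incl

end LinAlg

open LinAlg

/-! ### The standing data -/

/-- A connected reductive group `G` with a maximal torus `T`, a Borel subgroup `B ⊇ T`, root
vectors `e α` that together with a basis of `Lie(T)` form a basis of `Lie(G)`, and a linear form
`χ` on `Lie(G)` in standard Levi form with respect to a set `I` of simple roots. The values of
`e` outside the set of roots are irrelevant. -/
structure LeviDatum (K : Type u) [Field K] (n : ℕ) where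
  G : Subgroup (GL (Fin n) K)
  T : Subgroup (GL (Fin n) K)
  B : Subgroup (GL (Fin n) K)
  reductive : IsReductive G
  maximalTorus : IsMaximalTorus G T
  borel : IsBorel G B
  T_le_B : T ≤ B
  e : Chars T → lieAlg G
  e_mem : ∀ α ∈ roots G T, e α ∈ weightSpace G T α
  e_linearIndependent : LinearIndependent K (fun α : roots G T => e α)
  e_isCompl : IsCompl (Submodule.span K (e '' roots G T)) (cartan G T).toSubmodule
  I : Set (Chars T)
  I_subset : I ⊆ simpleRoots B T
  χ : Module.Dual K (lieAlg G)
  χ_borel : ∀ x : lieAlg G, (x : Matrix (Fin n) (Fin n) K) ∈ lieAlg B → χ x = 0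
  χ_neg_mem : ∀ α ∈ roots B T, α ∈ I → χ (e (-α)) = 1
  χ_neg_notMem : ∀ α ∈ roots B T, α ∉ I → χ (e (-α)) = 0

namespace LeviDatum

variable {K : Type u} [Field K] {n : ℕ} (D : LeviDatum K n)

/-- The character lattice `X = X(T)`. -/
abbrev X : Type u := Chars D.T

/-- The root system `R`. -/
abbrev R : Set D.X := roots D.G D.T

/-- The positive roots: the nonzero weights of `T` on `Lie(B)`. -/
abbrev Rpos : Set D.X := roots D.B D.T

/-- `𝔤 = Lie(G)`. -/
abbrev g : Type u := lieAlg D.G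

/-- `𝔥 = Lie(T)`, as a subalgebra of `𝔤`. -/
noncomputable abbrev h : LieSubalgebra K D.g := cartan D.G D.T

theorem T_le_G : D.T ≤ D.G := D.maximalTorus.prop.1

/-- The differential `dμ ∈ 𝔥^*` of `μ ∈ X`. -/
noncomputable def d : D.X →+ Module.Dual K D.h where
  toFun μ :=
    { toFun := fun x => diff D.T μ ⟨((x : D.g) : Matrix (Fin n) (Fin n) K), x.2⟩
      map_add' := fun x y => (diff D.T μ).map_add ⟨_, x.2⟩ ⟨_, y.2⟩
      map_smul' := fun r x => (diff D.T μ).map_smul r ⟨_, x.2⟩ }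
  map_zero' := by
    ext x
    simp
  map_add' := by
    intro a b
    refine LinearMap.ext fun x => ?_
    simp only [map_add]
    rfl

theorem torus_comm {s t : GL (Fin n) K} (hs : s ∈ D.T) (ht : t ∈ D.T) : s * t = t * s := by
  obtain ⟨g, hg⟩ := D.maximalTorus.prop.2.2
  have h1 := hg s hs
  have h2 := hg t ht
  have h3 : (g * s * g⁻¹) * (g * t * g⁻¹) = (g * t * g⁻¹) * (g * s * g⁻¹) := by
    apply Units.ext
    rw [Units.val_mul (g * s * g⁻¹), Units.val_mul (g * t * g⁻¹), ← h1.diagonal_diag, ← h2.diagonal_diag,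
      Matrix.diagonal_mul_diagonal, Matrix.diagonal_mul_diagonal]
    congr 1
    funext i
    exact mul_comm _ _
  have h4 : g * (s * t) * g⁻¹ = g * (t * s) * g⁻¹ := by
    calc g * (s * t) * g⁻¹ = (g * s * g⁻¹) * (g * t * g⁻¹) := by group
      _ = (g * t * g⁻¹) * (g * s * g⁻¹) := h3
      _ = g * (t * s) * g⁻¹ := by group
  exact mul_left_cancel (mul_right_cancel h4)

/-- A matrix that commutes with a subgroup commutes with its Lie algebra. -/
theorem commute_lieAlg {H : Subgroup (GL (Fin n) K)} {y : Matrix (Fin n) (Fin n) K}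
    (hy : ∀ t ∈ H, (t : Matrix (Fin n) (Fin n) K) * y = y * t)
    {x : Matrix (Fin n) (Fin n) K} (hx : x ∈ lieAlg H) : x * y = y * x := by
  ext i j
  have hmem : (∑ k, y k j • MvPolynomial.X (Sum.inl (i, k)) -
      ∑ k, y i k • MvPolynomial.X (Sum.inl (k, j)) : Coord K n) ∈ vanishing H := by
    rw [mem_vanishing]
    intro t ht
    have := congrFun (congrFun (hy t ht) i) j
    simp only [Matrix.mul_apply] at this
    simp only [evalAt, map_sub, map_sum, map_smul, MvPolynomial.aeval_X, Sum.elim_inl,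
      smul_eq_mul]
    rw [← this, sub_eq_zero]
    exact Finset.sum_congr rfl fun k _ => mul_comm _ _
  have h2 := hx _ hmem
  simp only [invDer, evalAt, map_sub, map_sum, Derivation.map_smul, map_smul,
    MvPolynomial.mkDerivation_X, MvPolynomial.aeval_X, Sum.elim_inl, smul_eq_mul,
    Units.val_one, Matrix.one_apply, mul_ite, mul_one, mul_zero, Finset.sum_ite_eq,
    Finset.mem_univ, if_true, sub_eq_zero] at h2
  simp only [Matrix.mul_apply]
  rw [← h2]
  exact Finset.sum_congr rfl fun k _ => mul_comm _ _

theorem h_comm_torus {x : D.g} (hx : x ∈ D.h) {t : GL (Fin n) K} (ht : t ∈ D.T) :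
    (t : Matrix (Fin n) (Fin n) K) * (x : Matrix (Fin n) (Fin n) K) =
      (x : Matrix (Fin n) (Fin n) K) * t := by
  refine (commute_lieAlg (H := D.T) (fun s hs => ?_) hx).symm
  exact congrArg Units.val (D.torus_comm hs ht)

theorem h_lie_eq_zero (x y : D.h) : ⁅x, y⁆ = 0 := by
  apply Subtype.ext
  apply Subtype.ext
  have := commute_lieAlg (H := D.T) (fun t ht => D.h_comm_torus y.2 ht) x.2
  simpa [Ring.lie_def, sub_eq_zero] using this

/-- Elements of `𝔤` that are fixed by `T` lie in `𝔥`. -/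
theorem mem_h_of_fixed (x : D.g) (hx : x ∈ weightSpace D.G D.T 0) : x ∈ D.h := by
  have htop : x ∈ Submodule.span K (D.e '' D.R) ⊔ (cartan D.G D.T).toSubmodule := by
    rw [D.e_isCompl.sup_eq_top]
    trivial
  obtain ⟨s, hs, y, hy, rfl⟩ := Submodule.mem_sup.1 htop
  have hy0 : y ∈ weightSpace D.G D.T 0 := by
    intro t
    rw [D.h_comm_torus hy t.2, mul_assoc, ← Units.val_mul, mul_inv_cancel, Units.val_one,
      mul_one, Chars.val_zero, one_smul]
  have hs0 : s ∈ weightSpace D.G D.T 0 := by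
    simpa using (weightSpace D.G D.T 0).sub_mem hx hy0
  rw [Set.image_eq_range, Finsupp.mem_span_range_iff_exists_finsupp] at hs
  obtain ⟨c, rfl⟩ := hs
  have hc : c = 0 := by
    ext α
    by_contra hne
    apply α.2.1
    apply Chars.ext_val
    intro t
    have h1 := hs0 t
    have h2 : c.sum (fun (i : D.R) a => (a * (Chars.val (i : D.X) t - 1)) • D.e i) = 0 := by
      apply Subtype.ext
      simp only [Finsupp.sum, Chars.val_zero, one_smul] at h1 ⊢
      have coe_sum : ∀ (F : D.R → D.g), ((∑ i ∈ c.support, F i : D.g) :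
          Matrix (Fin n) (Fin n) K) = ∑ i ∈ c.support, (F i : Matrix (Fin n) (Fin n) K) :=
        fun F => map_sum (lieAlg D.G).incl F _
      rw [coe_sum] at h1 ⊢
      rw [Finset.mul_sum, Finset.sum_mul] at h1
      have h3 := sub_eq_zero.2 h1
      rw [← Finset.sum_sub_distrib] at h3
      refine Eq.trans (Finset.sum_congr rfl fun i _ => ?_) h3
      have h4 := D.e_mem i i.2 t
      rw [SetLike.val_smul, SetLike.val_smul, Matrix.mul_smul, Matrix.smul_mul, h4, mul_sub, mul_one, sub_smul, smul_smul]
    have h5 := linearIndependent_iff'.1 D.e_linearIndependent c.support _ h2 α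
      (Finsupp.mem_support_iff.2 hne)
    rw [Chars.val_zero]
    exact sub_eq_zero.1 ((mul_eq_zero.1 h5).resolve_left hne)
  subst hc
  simpa using hy

theorem lie_e_mem_h {α : D.X} (hα : α ∈ D.R) (hα' : -α ∈ D.R) : ⁅D.e α, D.e (-α)⁆ ∈ D.h := by
  apply D.mem_h_of_fixed
  intro t
  have h1 := D.e_mem α hα t
  have h2 := D.e_mem _ hα' t
  have h3 : Chars.val α t * Chars.val (-α) t = 1 := by
    rw [← Chars.val_add, add_neg_cancel, Chars.val_zero]
  have conj : ∀ a b : Matrix (Fin n) (Fin n) K,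
      ((t : GL (Fin n) K) : Matrix (Fin n) (Fin n) K) * (a * b) *
        (((t : GL (Fin n) K)⁻¹ : GL (Fin n) K) : Matrix (Fin n) (Fin n) K) =
      (((t : GL (Fin n) K) : Matrix (Fin n) (Fin n) K) * a *
        (((t : GL (Fin n) K)⁻¹ : GL (Fin n) K) : Matrix (Fin n) (Fin n) K)) *
      (((t : GL (Fin n) K) : Matrix (Fin n) (Fin n) K) * b *
        (((t : GL (Fin n) K)⁻¹ : GL (Fin n) K) : Matrix (Fin n) (Fin n) K)) := by
    intro a b
    have : (((t : GL (Fin n) K)⁻¹ : GL (Fin n) K) : Matrix (Fin n) (Fin n) K) *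
        ((t : GL (Fin n) K) : Matrix (Fin n) (Fin n) K) = 1 := by
      rw [← Units.val_mul, inv_mul_cancel, Units.val_one]
    simp only [mul_assoc]
    rw [← mul_assoc _ ((t : GL (Fin n) K) : Matrix (Fin n) (Fin n) K) (b * _), this, one_mul]
  rw [LieSubalgebra.coe_bracket, Ring.lie_def, mul_sub, sub_mul, conj, conj, h1, h2,
    Chars.val_zero, one_smul]
  simp only [Matrix.mul_smul, Matrix.smul_mul, smul_smul]
  rw [mul_comm (Chars.val (-α) t), h3, one_smul, one_smul]

/-! ### The algebras -/

/-- `U⁰ = U(𝔥)`. -/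
abbrev U0 : Type u := UniversalEnvelopingAlgebra K D.h

/-- The relations `e_α ^ p = χ(e_α) ^ p`, `α ∈ R`, in `U(𝔤)`. -/
inductive Rel (p : ℕ) : UniversalEnvelopingAlgebra K D.g → UniversalEnvelopingAlgebra K D.g → Prop
  | pow (α : D.X) (hα : α ∈ D.R) :
      Rel p (UniversalEnvelopingAlgebra.ι K (D.e α) ^ p) (algebraMap K _ (D.χ (D.e α) ^ p))

/-- `U_χ = U(𝔤) / ⟨e_α ^ p - χ(e_α) ^ p | α ∈ R⟩`. -/
abbrev Uχ (p : ℕ) : Type u := RingQuot (D.Rel p)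

/-- The map `𝔤 → U_χ`. -/
noncomputable def gen (p : ℕ) : D.g →ₗ⁅K⁆ D.Uχ p :=
  ((RingQuot.mkAlgHom K (D.Rel p)) : _ →ₗ⁅K⁆ D.Uχ p).comp (UniversalEnvelopingAlgebra.ι K)

/-- The map `U⁰ → U_χ`. -/
noncomputable def ofU0 (p : ℕ) : D.U0 →ₐ[K] D.Uχ p :=
  UniversalEnvelopingAlgebra.lift K ((D.gen p).comp D.h.incl)

/-- The algebra endomorphism of `U⁰` with `x ↦ x + φ(x)` for `x ∈ 𝔥`; for `φ = dμ` it is the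
automorphism usually denoted by `μ` with a tilde. -/
noncomputable def shift (φ : Module.Dual K D.h) : D.U0 →ₐ[K] D.U0 :=
  UniversalEnvelopingAlgebra.lift K
    { toFun := fun x => UniversalEnvelopingAlgebra.ι K x + algebraMap K D.U0 (φ x)
      map_add' := fun x y => by
        simp only [map_add]
        abel
      map_smul' := fun r x => by
        simp [Algebra.smul_def, mul_add]
      map_lie' := by
        intro x y
        have h0 : ⁅UniversalEnvelopingAlgebra.ι K x, UniversalEnvelopingAlgebra.ι K y⁆ =
            (0 : D.U0) := by
          rw [← LieHom.map_lie, D.h_lie_eq_zero, map_zero]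
        have h1 := Algebra.commutes (φ x) (UniversalEnvelopingAlgebra.ι K y : D.U0)
        have h2 := Algebra.commutes (φ y) (UniversalEnvelopingAlgebra.ι K x : D.U0)
        have h3 := Algebra.commutes (φ x) (algebraMap K D.U0 (φ y))
        rw [D.h_lie_eq_zero]
        rw [Ring.lie_def] at h0 ⊢
        simp only [map_zero, add_zero, mul_add, add_mul, h1, h2, h3]
        rw [sub_eq_zero] at h0
        rw [h0]
        abel }

/-- The subgroup `ℤI` of `X`. -/
abbrev ZI : AddSubgroup D.X := AddSubgroup.closure D.I

/-- The grading group `X / ℤI`. -/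
abbrev Gr : Type u := D.X ⧸ D.ZI

/-- The class `λ + ℤI`. -/
abbrev cls (μ : D.X) : D.Gr := QuotientAddGroup.mk μ

/-- `D.Monomial p u c`: the element `u` of `U_χ` is a product of elements of `𝔥` and of root
vectors `e_α`, and `c` is the sum of the classes `α + ℤI` of the latter. -/
inductive Monomial (p : ℕ) : D.Uχ p → D.Gr → Prop
  | one : Monomial p 1 0
  | h_mul (x : D.h) {u : D.Uχ p} {c : D.Gr} : Monomial p u c →
      Monomial p (D.gen p (x : D.g) * u) c
  | e_mul (α : D.X) (hα : α ∈ D.R) {u : D.Uχ p} {c : D.Gr} : Monomial p u c →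
      Monomial p (D.gen p (D.e α) * u) (D.cls α + c)

/-- The graded piece `(U_χ)_c` for `c ∈ X / ℤI`. -/
noncomputable def grade (p : ℕ) (c : D.Gr) : Submodule K (D.Uχ p) :=
  Submodule.span K {u | D.Monomial p u c}

/-- `(U_χ)_c^φ`: the elements of `(U_χ)_c` on which `𝔥` acts, through commutators, with
weight `φ`. -/
noncomputable def gradeWeight (p : ℕ) (c : D.Gr) (φ : Module.Dual K D.h) : Submodule K (D.Uχ p) where
  carrier := {u | u ∈ D.grade p c ∧
    ∀ x : D.h, D.gen p (x : D.g) * u - u * D.gen p (x : D.g) = φ x • u}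
  add_mem' := by
    rintro a b ⟨ha, ha'⟩ ⟨hb, hb'⟩
    refine ⟨add_mem ha hb, fun x => ?_⟩
    rw [smul_add, ← ha' x, ← hb' x, mul_add, add_mul]
    abel
  zero_mem' := ⟨zero_mem _, fun x => by simp⟩
  smul_mem' := by
    rintro r a ⟨ha, ha'⟩
    refine ⟨Submodule.smul_mem _ r ha, fun x => ?_⟩
    rw [smul_comm, ← ha' x, smul_sub, mul_smul_comm, smul_mul_assoc]

/-! ### The category `𝒞_A` -/

variable (p : ℕ) {A : Type v} [CommRing A] [Algebra K A]

/-- A `U_χ ⊗ A`-module (commuting actions of `U_χ` and `A` that agree on `K`) together with a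
family of `A`-submodules `M_c^φ`, `c ∈ X / ℤI`, `φ ∈ 𝔥^*`. -/
structure PreObj (A : Type v) [CommRing A] [Algebra K A] where
  carrier : Type (max u v)
  [addCommGroup : AddCommGroup carrier]
  [moduleU : Module (D.Uχ p) carrier]
  [moduleA : Module A carrier]
  [smulCommClass : SMulCommClass (D.Uχ p) A carrier]
  algebraMap_smul : ∀ (k : K) (m : carrier),
    algebraMap K (D.Uχ p) k • m = algebraMap K A k • m
  piece : D.Gr → Module.Dual K D.h → Submodule A carrier

attribute [instance] PreObj.addCommGroup PreObj.moduleU PreObj.moduleA PreObj.smulCommClass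

variable {D p}

/-- `M_c`, the sum of all the `M_c^φ`. -/
def PreObj.gradePiece (M : D.PreObj p A) (c : D.Gr) : Submodule A M.carrier := ⨆ φ, M.piece c φ

/-- The conditions on the objects of `𝒞_A`, for the structure map `π : U⁰ → A`. -/
structure PreObj.IsObj (π : D.U0 →ₐ[K] A) (M : D.PreObj p A) : Prop where
  /-- `M` is the direct sum of the `M_c^φ`. -/
  indep : iSupIndep fun i : D.Gr × Module.Dual K D.h => M.piece i.1 i.2
  iSup_eq_top : ⨆ i : D.Gr × Module.Dual K D.h, M.piece i.1 i.2 = ⊤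
  /-- In `M_c` only the weights `φ = dμ` with `μ ∈ c + pX` occur. -/
  weights : ∀ c φ, M.piece c φ ≠ ⊥ → ∃ μ τ : D.X, D.cls (μ + p • τ) = c ∧ D.d μ = φ
  finite : {c | M.gradePiece c ≠ ⊥}.Finite
  fg : ∀ c, (M.gradePiece c).FG
  grade_smul : ∀ (b c : D.Gr), ∀ u ∈ D.grade p b, ∀ m ∈ M.gradePiece c,
    u • m ∈ M.gradePiece (b + c)
  U0_smul : ∀ (c : D.Gr) (φ : Module.Dual K D.h) (s : D.U0), ∀ m ∈ M.piece c φ,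
    D.ofU0 p s • m = π (D.shift φ s) • m
  e_smul : ∀ α ∈ D.R, ∀ (c : D.Gr) (φ : Module.Dual K D.h), ∀ m ∈ M.piece c φ,
    D.gen p (D.e α) • m ∈ M.piece (D.cls α + c) (φ + D.d α)

/-- Morphisms: homomorphisms of `U_χ ⊗ A`-modules that preserve the pieces `M_c^φ`. -/
structure PreObj.Mor (M N : D.PreObj p A) where
  toFun : M.carrier →ₗ[A] N.carrier
  map_smulU : ∀ (u : D.Uχ p) (m : M.carrier), toFun (u • m) = u • toFun m
  map_piece : ∀ c φ, ∀ m ∈ M.piece c φ, toFun m ∈ N.piece c φ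

/-! ### Baby Verma modules -/

/-- The left ideal of `U_χ ⊗ A` generated by the `e_α ⊗ 1`, `α ∈ R⁺`, and by the
`s ⊗ 1 - 1 ⊗ π(λ(s))`, `s ∈ U⁰`, where `λ` acts on `U⁰` by `shift (dλ)`. -/
noncomputable def vermaIdeal (π : D.U0 →ₐ[K] A) (l : D.X) : Submodule (D.Uχ p ⊗[K] A) (D.Uχ p ⊗[K] A) :=
  Submodule.span _
    ({z | ∃ α ∈ D.Rpos, z = D.gen p (D.e α) ⊗ₜ[K] (1 : A)} ∪
     {z | ∃ s : D.U0, z = D.ofU0 p s ⊗ₜ[K] (1 : A) - 1 ⊗ₜ[K] π (D.shift (D.d l) s)})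

variable (p) in
/-- The `U_χ ⊗ A`-module `U_χ ⊗_{U⁰U⁺} A^λ`, presented as the quotient of `U_χ ⊗ A` by the left
ideal generated by the relations that define the `U⁰U⁺ ⊗ A`-module `A^λ`. -/
noncomputable def VermaModule (π : D.U0 →ₐ[K] A) (l : D.X) : Type (max u v) :=
  (D.Uχ p ⊗[K] A) ⧸ vermaIdeal (p := p) π l

noncomputable instance (π : D.U0 →ₐ[K] A) (l : D.X) : AddCommGroup (VermaModule p π l) :=
  inferInstanceAs (AddCommGroup ((D.Uχ p ⊗[K] A) ⧸ vermaIdeal (p := p) π l))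

noncomputable instance (π : D.U0 →ₐ[K] A) (l : D.X) :
    Module (D.Uχ p ⊗[K] A) (VermaModule p π l) :=
  inferInstanceAs (Module (D.Uχ p ⊗[K] A) ((D.Uχ p ⊗[K] A) ⧸ vermaIdeal (p := p) π l))

noncomputable instance (π : D.U0 →ₐ[K] A) (l : D.X) : Module (D.Uχ p) (VermaModule p π l) :=
  Module.compHom _
    (Algebra.TensorProduct.includeLeft : D.Uχ p →ₐ[K] D.Uχ p ⊗[K] A).toRingHom

noncomputable instance (π : D.U0 →ₐ[K] A) (l : D.X) : Module A (VermaModule p π l) :=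
  Module.compHom _
    (Algebra.TensorProduct.includeRight : A →ₐ[K] D.Uχ p ⊗[K] A).toRingHom

theorem VermaModule.smulU_def (π : D.U0 →ₐ[K] A) (l : D.X) (x : D.Uχ p)
    (m : VermaModule p π l) : x • m = (x ⊗ₜ[K] (1 : A)) • m := rfl

theorem VermaModule.smulA_def (π : D.U0 →ₐ[K] A) (l : D.X) (a : A)
    (m : VermaModule p π l) : a • m = ((1 : D.Uχ p) ⊗ₜ[K] a) • m := rfl

instance (π : D.U0 →ₐ[K] A) (l : D.X) : SMulCommClass (D.Uχ p) A (VermaModule p π l) where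
  smul_comm x a m := by
    simp only [VermaModule.smulU_def, VermaModule.smulA_def, smul_smul,
      Algebra.TensorProduct.tmul_mul_tmul, one_mul, mul_one]

variable (p) in
/-- The standard generator of the baby Verma module. -/
noncomputable def VermaModule.vec (π : D.U0 →ₐ[K] A) (l : D.X) : VermaModule p π l :=
  Submodule.Quotient.mk (p := vermaIdeal (p := p) π l) 1

variable (p) in
/-- The baby Verma module `Z_{A,χ}(λ)`. -/
noncomputable def babyVerma (π : D.U0 →ₐ[K] A) (l : D.X) : D.PreObj p A where
  carrier := VermaModule p π l
  algebraMap_smul k m := by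
    rw [VermaModule.smulU_def, VermaModule.smulA_def, Algebra.algebraMap_eq_smul_one,
      Algebra.algebraMap_eq_smul_one, TensorProduct.smul_tmul]
  piece c φ := Submodule.span A
    {m | ∃ w ∈ D.gradeWeight p (c - D.cls l) (φ - D.d l), m = w • VermaModule.vec p π l}

/-! ### Blocks -/

variable (p) in
/-- `Hom(Z_{A,χ}(λ), Z_{A,χ}(μ)) ≠ 0` in `𝒞_A`. -/
def HomNonzero (π : D.U0 →ₐ[K] A) (l m : D.X) : Prop :=
  ∃ f : (babyVerma p π l).Mor (babyVerma p π m), f.toFun ≠ 0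

variable (p) in
/-- `Ext¹(Z_{A,χ}(λ), Z_{A,χ}(μ)) ≠ 0` in `𝒞_A`: there is a non-split short exact sequence
`0 → Z_{A,χ}(μ) → E → Z_{A,χ}(λ) → 0` in `𝒞_A`. -/
def ExtNonzero (π : D.U0 →ₐ[K] A) (l m : D.X) : Prop :=
  ∃ (E : D.PreObj p A) (_ : E.IsObj π) (i : (babyVerma p π m).Mor E) (q : E.Mor (babyVerma p π l)),
    Function.Injective i.toFun ∧ LinearMap.range i.toFun = LinearMap.ker q.toFun ∧
    Function.Surjective q.toFun ∧
    ¬ ∃ s : (babyVerma p π l).Mor E, q.toFun ∘ₗ s.toFun = LinearMap.id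

variable (p) in
/-- `λ` and `μ` lie in the same block over `A`: they are equivalent under the smallest
equivalence relation on `X` that relates `λ` and `μ` whenever `Hom(Z_{A,χ}(λ), Z_{A,χ}(μ))` or
`Ext¹(Z_{A,χ}(λ), Z_{A,χ}(μ))`, formed in `𝒞_A`, is nonzero. -/
def SameBlock (π : D.U0 →ₐ[K] A) : D.X → D.X → Prop :=
  Relation.EqvGen fun l m => HomNonzero p π l m ∨ ExtNonzero p π l m

/-- The structure map `U⁰ → A → F` of the residue field `F` of `A`. -/
noncomputable def residueMap [IsLocalRing A] (π : D.U0 →ₐ[K] A) :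
    D.U0 →ₐ[K] IsLocalRing.ResidueField A :=
  (IsScalarTower.toAlgHom K A (IsLocalRing.ResidueField A)).comp π

end LeviDatum

/-!
Since `π(h_α) = 0` for all roots, `π|_𝔥` extends to a linear form `ε : 𝔤 → A` that vanishes on the
root vectors and on all brackets. Adding the scalars `ε(x)` to the action of `x ∈ 𝔤` identifies
`𝒞_A` for the trivial structure map with `𝒞_A` for `π`, and baby Verma modules correspond to baby
Verma modules. For the trivial structure map a baby Verma module over `A` is the base change of
the one over `K`. Nonzero homomorphisms descend along `K → A` by applying linear forms `A → K`.
So do nonsplit extensions: being projective over `A`, a base change splits off as a graded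
`A`-module, so extensions are described by cocycles, and a cocycle is a coboundary as soon as all
its slices along linear forms are. Thus the blocks over `A` depend neither on `A` nor on `π`.
-/

/-! ### Gradings and base change of linear maps -/

namespace LinAlg

section Gradings

theorem inf_iSup_eq_of_iSupIndep {ι α : Type*} [CompleteLattice α] [IsModularLattice α]
    {P Q : ι → α} (hQ : iSupIndep Q) (hPQ : P ≤ Q) (j : ι) : Q j ⊓ ⨆ i, P i = P j := by
  have hdisj : Q j ⊓ ⨆ (i) (_ : i ≠ j), P i = ⊥ :=
    ((hQ j).mono_right (iSup₂_mono fun i _ => hPQ i)).eq_bot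
  rw [iSup_split_single P j, inf_comm, sup_inf_assoc_of_le _ (hPQ j), inf_comm, hdisj, sup_bot_eq]

theorem eq_of_le_of_iSup_eq_top {ι α : Type*} [CompleteLattice α] [IsModularLattice α]
    {P Q : ι → α} (hQ : iSupIndep Q) (hPQ : P ≤ Q) (hP : ⨆ i, P i = ⊤) : P = Q :=
  funext fun j => by rw [← inf_iSup_eq_of_iSupIndep hQ hPQ j, hP, inf_top_eq]

variable {ι κ R M N : Type*} [Ring R] [AddCommGroup M] [Module R M] [AddCommGroup N] [Module R N]

theorem iSupIndep_map_of_ker_le {Q : ι → Submodule R M} (hQ : iSupIndep Q) (f : M →ₗ[R] N)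
    (hker : LinearMap.ker f ≤ ⨆ j, LinearMap.ker f ⊓ Q j) :
    iSupIndep fun j => (Q j).map f := by
  intro j
  rw [Submodule.disjoint_def]
  rintro _ ⟨a, ha, rfl⟩ hfa
  simp only [← Submodule.map_iSup] at hfa
  obtain ⟨b, hb, hba⟩ := hfa
  have hab : a - b ∈ ⨆ i, LinearMap.ker f ⊓ Q i :=
    hker (by rw [LinearMap.mem_ker, map_sub, hba, sub_self])
  rw [iSup_split_single _ j] at hab
  obtain ⟨k, ⟨hk, hkj⟩, k', hk', hsum⟩ := Submodule.mem_sup.1 hab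
  have hak : a - k = b + k' := by rw [sub_eq_iff_eq_add, add_assoc, add_comm k', hsum]; abel
  have hak_mem : a - k ∈ ⨆ (i) (_ : i ≠ j), Q i :=
    hak ▸ add_mem hb ((iSup₂_mono fun i _ => inf_le_right :
      _ ≤ ⨆ (i) (_ : i ≠ j), Q i) hk')
  have hak_zero := Submodule.disjoint_def.1 (hQ j) _ (sub_mem ha hkj) hak_mem
  rw [sub_eq_zero.1 hak_zero, LinearMap.mem_ker.1 hk]

theorem iSupIndep_comap {Q : ι → Submodule R N} (hQ : iSupIndep Q) {f : M →ₗ[R] N}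
    (hf : Function.Injective f) : iSupIndep fun j => (Q j).comap f := by
  intro j
  rw [Submodule.disjoint_def]
  intro x hx hx'
  refine hf ((Submodule.disjoint_def.1 (hQ j) _ hx ?_).trans (map_zero f).symm)
  exact (iSup₂_le fun i hi => Submodule.comap_mono (le_iSup₂_of_le i hi le_rfl) :
    _ ≤ (⨆ (i) (_ : i ≠ j), Q i).comap f) hx'

theorem iSupIndep_prod {P : ι → Submodule R M} {Q : ι → Submodule R N} (hP : iSupIndep P)
    (hQ : iSupIndep Q) : iSupIndep fun j => (P j).prod (Q j) := by
  intro j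
  rw [Submodule.disjoint_def]
  rintro ⟨x, y⟩ ⟨hx, hy⟩ hxy
  obtain ⟨hx', hy'⟩ := (iSup₂_le fun i hi =>
    Submodule.prod_mono (le_iSup₂_of_le i hi le_rfl) (le_iSup₂_of_le i hi le_rfl) :
    _ ≤ (⨆ (i) (_ : i ≠ j), P i).prod (⨆ (i) (_ : i ≠ j), Q i)) hxy
  exact Prod.ext (Submodule.disjoint_def.1 (hP j) x hx hx')
    (Submodule.disjoint_def.1 (hQ j) y hy hy')

theorem iSup_prod_eq_top {P : ι → Submodule R M} {Q : ι → Submodule R N} (hP : ⨆ i, P i = ⊤)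
    (hQ : ⨆ i, Q i = ⊤) : ⨆ i, (P i).prod (Q i) = ⊤ := by
  have hinl : ⨆ i, P i ≤ (⨆ i, (P i).prod (Q i)).comap (LinearMap.inl R M N) :=
    iSup_le fun i x hx => Submodule.mem_iSup_of_mem i ⟨hx, zero_mem _⟩
  have hinr : ⨆ i, Q i ≤ (⨆ i, (P i).prod (Q i)).comap (LinearMap.inr R M N) :=
    iSup_le fun i x hx => Submodule.mem_iSup_of_mem i ⟨zero_mem _, hx⟩
  rw [hP] at hinl
  rw [hQ] at hinr
  refine eq_top_iff.2 fun x _ => ?_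
  rw [← Prod.fst_add_snd x]
  exact add_mem (hinl (x := x.1) trivial) (hinr (x := x.2) trivial)

variable [DecidableEq ι] [DecidableEq κ] (P : ι → Submodule R M) (Q : κ → Submodule R N)
  [DirectSum.Decomposition P] [DirectSum.Decomposition Q]

theorem coe_decompose_map {σ : ι → κ} (hσ : Function.Injective σ) {f : M →ₗ[R] N}
    (hf : ∀ j, ∀ m ∈ P j, f m ∈ Q (σ j)) (m : M) (j : ι) :
    (DirectSum.decompose Q (f m) (σ j) : N) = f (DirectSum.decompose P m j) := by
  induction m using DirectSum.Decomposition.inductionOn P with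
  | zero => simp
  | @homogeneous i m =>
    rcases eq_or_ne i j with rfl | hij
    · rw [DirectSum.decompose_of_mem_same Q (hf i m m.2), DirectSum.decompose_of_mem_same P m.2]
    · rw [DirectSum.decompose_of_mem_ne Q (hf i m m.2) (hσ.ne hij),
        DirectSum.decompose_of_mem_ne P m.2 hij, map_zero]
  | add m m' hm hm' => simp [DirectSum.decompose_add, hm, hm']

end Gradings

section GradedSection

variable {ι R E V : Type*} [Ring R] [AddCommGroup E] [Module R E] [AddCommGroup V] [Module R V]
  [DecidableEq ι] (P : ι → Submodule R E) (Q : ι → Submodule R V)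
  [DirectSum.Decomposition P] [DirectSum.Decomposition Q]

theorem exists_graded_section [Module.Projective R V] {q : E →ₗ[R] V}
    (hq : Function.Surjective q) (hqP : ∀ j, ∀ x ∈ P j, q x ∈ Q j) :
    ∃ s : V →ₗ[R] E, q ∘ₗ s = LinearMap.id ∧ ∀ j, ∀ x ∈ Q j, s x ∈ P j := by
  obtain ⟨s₀, hs₀⟩ := Module.projective_lifting_property q LinearMap.id hq
  let s : V →ₗ[R] E := DirectSum.toModule R ι E (fun j => (P j).subtype ∘ₗ
    DirectSum.component R ι (fun j => P j) j ∘ₗ (DirectSum.decomposeLinearEquiv P).toLinearMap ∘ₗ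
    s₀ ∘ₗ (Q j).subtype) ∘ₗ (DirectSum.decomposeLinearEquiv Q).toLinearMap
  have hs : ∀ j, ∀ x ∈ Q j, s x = DirectSum.decompose P (s₀ x) j := fun j x hx => by
    simp only [s, LinearMap.comp_apply, LinearEquiv.coe_coe, DirectSum.decomposeLinearEquiv_apply]
    rw [DirectSum.decompose_of_mem Q hx, ← DirectSum.lof_eq_of R, DirectSum.toModule_lof]
    rfl
  refine ⟨s, DirectSum.decompose_lhom_ext Q fun j => LinearMap.ext fun x => ?_,
    fun j x hx => hs j x hx ▸ Subtype.coe_prop _⟩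
  have hqs₀ : q (s₀ x) = x := DFunLike.congr_fun hs₀ (x : V)
  calc q (s x) = DirectSum.decompose Q (q (s₀ x)) j :=
        (congrArg q (hs j x x.2)).trans
          (coe_decompose_map P Q Function.injective_id hqP (s₀ x) j).symm
    _ = x := by rw [hqs₀, DirectSum.decompose_of_mem_same Q x.2]

end GradedSection

section Slices

variable {K A V W : Type*} [Field K] [CommRing A] [Algebra K A] [AddCommGroup V] [Module K V]
  [AddCommGroup W] [Module K W]

/-- The contraction `A ⊗ V → V` along a linear form on `A`. -/
noncomputable def slice (σ : Module.Dual K A) : A ⊗[K] V →ₗ[K] V :=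
  (TensorProduct.lid K V).toLinearMap ∘ₗ σ.rTensor V

@[simp]
theorem slice_tmul (σ : Module.Dual K A) (a : A) (x : V) : slice σ (a ⊗ₜ[K] x) = σ a • x := by
  simp [slice]

theorem slice_baseChange (σ : Module.Dual K A) (f : V →ₗ[K] W) (t : A ⊗[K] V) :
    slice σ (f.baseChange A t) = f (slice σ t) := by
  induction t using TensorProduct.induction_on with
  | zero => simp
  | tmul a x => simp
  | add t t' ht ht' => simp only [map_add, ht, ht']

theorem slice_mem_of_mem_baseChange (σ : Module.Dual K A) {P : Submodule K V} {t : A ⊗[K] V}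
    (ht : t ∈ P.baseChange A) : slice σ t ∈ P := by
  obtain ⟨t, rfl⟩ := ht
  exact slice_baseChange σ P.subtype t ▸ Subtype.coe_prop _

theorem sum_basis_tmul_slice {κ : Type*} [DecidableEq κ] (b : Module.Basis κ K A) (t : A ⊗[K] V)
    {s : Finset κ} (hs : (TensorProduct.equivFinsuppOfBasisLeft b t).support ⊆ s) :
    ∑ k ∈ s, b k ⊗ₜ[K] slice (b.coord k) t = t := by
  conv_rhs => rw [← (TensorProduct.equivFinsuppOfBasisLeft b).symm_apply_apply t,
    TensorProduct.equivFinsuppOfBasisLeft_symm_apply]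
  rw [Finsupp.sum_of_support_subset _ hs _ fun k _ => TensorProduct.tmul_zero _ _]
  simp only [TensorProduct.equivFinsuppOfBasisLeft_apply, slice, LinearMap.comp_apply,
    LinearEquiv.coe_coe]

theorem eq_zero_of_forall_slice_eq_zero {t : A ⊗[K] V} (ht : ∀ σ : Module.Dual K A, slice σ t = 0) :
    t = 0 := by
  classical
  rw [← sum_basis_tmul_slice (Module.Basis.ofVectorSpace K A) t subset_rfl]
  simp only [ht, TensorProduct.tmul_zero, Finset.sum_const_zero]

theorem exists_finset_forall_sum_basis_tmul_slice [Module.Finite K W] {κ : Type*}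
    (b : Module.Basis κ K A) (f : W →ₗ[K] A ⊗[K] V) :
    ∃ s : Finset κ, ∀ x, ∑ k ∈ s, b k ⊗ₜ[K] slice (b.coord k) (f x) = f x := by
  classical
  obtain ⟨t, ht⟩ := Module.finite_def.1 ‹Module.Finite K W›
  let s := t.biUnion fun y => (TensorProduct.equivFinsuppOfBasisLeft b (f y)).support
  have hs : (∑ k ∈ s, TensorProduct.mk K A V (b k) ∘ₗ slice (b.coord k)) ∘ₗ f = f :=
    LinearMap.ext_on ht fun y hy => by
      simpa using sum_basis_tmul_slice b (f y) (Finset.subset_biUnion_of_mem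
        (fun y => (TensorProduct.equivFinsuppOfBasisLeft b (f y)).support) hy)
  exact ⟨s, fun x => by simpa using DFunLike.congr_fun hs x⟩

end Slices

section BaseChange

variable {ι K A V W : Type*} [Field K] [CommRing A] [Algebra K A] [AddCommGroup V] [Module K V]
  [AddCommGroup W] [Module K W]

theorem baseChange_mem_baseChange {f : V →ₗ[K] W} {P : Submodule K V} {Q : Submodule K W}
    (hf : ∀ x ∈ P, f x ∈ Q) {t : A ⊗[K] V} (ht : t ∈ P.baseChange A) :
    f.baseChange A t ∈ Q.baseChange A := by
  rw [Submodule.baseChange_eq_span] at ht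
  refine (Submodule.span_le (p := (Q.baseChange A).comap (f.baseChange A))).2 ?_ ht
  exact fun _ ⟨x, hx, h⟩ => h ▸ Submodule.tmul_mem_baseChange_of_mem 1 (hf x hx)

theorem baseChange_eq_smul_of_mem_baseChange {f : V →ₗ[K] V} {P : Submodule K V} {c : K}
    (hf : ∀ x ∈ P, f x = c • x) {t : A ⊗[K] V} (ht : t ∈ P.baseChange A) :
    f.baseChange A t = algebraMap K A c • t := by
  rw [Submodule.baseChange_eq_span] at ht
  refine LinearMap.eqOn_span (f := f.baseChange A)
    (g := LinearMap.lsmul A (A ⊗[K] V) (algebraMap K A c)) ?_ ht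
  rintro _ ⟨x, hx, rfl⟩
  simp [hf x hx]

/-- The slice along `σ` of a map between base changes: the map `V → W` induced by `1 ⊗ V ⊆ A ⊗ V`
and the contraction along `σ`. -/
noncomputable def sliceHom (σ : Module.Dual K A) (F : A ⊗[K] V →ₗ[A] A ⊗[K] W) : V →ₗ[K] W :=
  slice σ ∘ₗ F.restrictScalars K ∘ₗ TensorProduct.mk K A V 1

theorem sliceHom_apply (σ : Module.Dual K A) (F : A ⊗[K] V →ₗ[A] A ⊗[K] W) (x : V) :
    sliceHom σ F x = slice σ (F (1 ⊗ₜ[K] x)) := rfl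

theorem eq_zero_of_forall_sliceHom_eq_zero {F : A ⊗[K] V →ₗ[A] A ⊗[K] W}
    (hF : ∀ σ : Module.Dual K A, sliceHom σ F = 0) : F = 0 :=
  TensorProduct.AlgebraTensorModule.curry_injective <| LinearMap.ext_ring <| LinearMap.ext fun x =>
    eq_zero_of_forall_slice_eq_zero fun σ => LinearMap.congr_fun (hF σ) x

theorem exists_sliceHom_baseChange_eq [Nontrivial A] :
    ∃ σ : Module.Dual K A, ∀ f : V →ₗ[K] W, sliceHom σ (f.baseChange A) = f := by
  obtain ⟨σ, hσ⟩ := Module.Projective.exists_dual_eq_one K (one_ne_zero (α := A))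
  exact ⟨σ, fun f => LinearMap.ext fun x => by simp [sliceHom_apply, hσ]⟩

theorem baseChange_iSup {κ : Sort*} (P : κ → Submodule K V) :
    (⨆ i, P i).baseChange A = ⨆ i, (P i).baseChange A := by
  let Q := (⨆ i, (P i).baseChange A).restrictScalars K |>.comap (TensorProduct.mk K A V 1)
  have hPQ : ⨆ i, P i ≤ Q := iSup_le fun i x hx =>
    Submodule.mem_iSup_of_mem i (Submodule.tmul_mem_baseChange_of_mem 1 hx)
  refine le_antisymm ?_ (iSup_le fun i => ?_) <;> rw [Submodule.baseChange_eq_span]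
  · exact Submodule.span_le.2 fun _ ⟨x, hx, h⟩ => h ▸ hPQ hx
  · exact Submodule.span_le.2 fun _ ⟨x, hx, h⟩ =>
      h ▸ Submodule.tmul_mem_baseChange_of_mem 1 (Submodule.mem_iSup_of_mem i hx)

theorem iSupIndep_baseChange {P : ι → Submodule K V} (hP : iSupIndep P) :
    iSupIndep fun i => (P i).baseChange A := by
  intro j
  rw [Submodule.disjoint_def]
  intro t ht ht'
  simp only [← baseChange_iSup] at ht'
  exact eq_zero_of_forall_slice_eq_zero fun σ => Submodule.disjoint_def.1 (hP j) _
    (slice_mem_of_mem_baseChange σ ht) (slice_mem_of_mem_baseChange σ ht')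

theorem iSupIndep_of_baseChange [Nontrivial A] {P : ι → Submodule K V}
    (hP : iSupIndep fun i => (P i).baseChange A) : iSupIndep P := by
  intro j
  rw [Submodule.disjoint_def]
  intro x hx hx'
  obtain ⟨σ, hσ⟩ := Module.Projective.exists_dual_eq_one K (one_ne_zero (α := A))
  have hx0 : (1 : A) ⊗ₜ[K] x = 0 := Submodule.disjoint_def.1 (hP j) _
    (Submodule.tmul_mem_baseChange_of_mem 1 hx) (by
      simp only [← baseChange_iSup]
      exact Submodule.tmul_mem_baseChange_of_mem 1 hx')
  simpa [hσ] using congrArg (slice σ) hx0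

end BaseChange

/-! ### Differentials of regular functions -/

section Differentials

variable {K : Type u} [Field K] {n : ℕ}

/-- The regular function `g ↦ (g Y)ᵢⱼ` on `GL_n`. -/
noncomputable def mulRightEntry (Y : Matrix (Fin n) (Fin n) K) (i j : Fin n) : Coord K n :=
  ∑ k, Y k j • MvPolynomial.X (Sum.inl (i, k))

/-- The regular function `g ↦ (Y g)ᵢⱼ` on `GL_n`. -/
noncomputable def mulLeftEntry (Y : Matrix (Fin n) (Fin n) K) (i j : Fin n) : Coord K n :=
  ∑ k, Y i k • MvPolynomial.X (Sum.inl (k, j))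

theorem evalAt_mulRightEntry (g : GL (Fin n) K) (Y : Matrix (Fin n) (Fin n) K) (i j : Fin n) :
    evalAt g (mulRightEntry Y i j) = ((g : Matrix (Fin n) (Fin n) K) * Y) i j := by
  simp [evalAt, mulRightEntry, Matrix.mul_apply, mul_comm]

theorem evalAt_mulLeftEntry (g : GL (Fin n) K) (Y : Matrix (Fin n) (Fin n) K) (i j : Fin n) :
    evalAt g (mulLeftEntry Y i j) = (Y * (g : Matrix (Fin n) (Fin n) K)) i j := by
  simp [evalAt, mulLeftEntry, Matrix.mul_apply]

theorem evalAt_one_invDer_mulRightEntry (x Y : Matrix (Fin n) (Fin n) K) (i j : Fin n) :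
    evalAt 1 (invDer x (mulRightEntry Y i j)) = (x * Y) i j := by
  simp [evalAt, invDer, mulRightEntry, Matrix.mul_apply, Matrix.one_apply, mul_comm]

theorem evalAt_one_invDer_mulLeftEntry (x Y : Matrix (Fin n) (Fin n) K) (i j : Fin n) :
    evalAt 1 (invDer x (mulLeftEntry Y i j)) = (Y * x) i j := by
  simp [evalAt, invDer, mulLeftEntry, Matrix.mul_apply, Matrix.one_apply]

theorem lie_eq_diff_smul {H : Subgroup (GL (Fin n) K)} (c : Chars H)
    {Y : Matrix (Fin n) (Fin n) K}
    (hY : ∀ t : H, ((t : GL (Fin n) K) : Matrix (Fin n) (Fin n) K) * Y =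
      c.val t • (Y * ((t : GL (Fin n) K) : Matrix (Fin n) (Fin n) K))) (x : lieAlg H) :
    ⁅(x : Matrix (Fin n) (Fin n) K), Y⁆ = diff H c x • Y := by
  obtain ⟨F, hF⟩ := c.exists_poly
  have hF_one : evalAt (1 : GL (Fin n) K) F = 1 := (hF 1).symm.trans c.val_one
  have hF_diff : evalAt 1 (invDer (x : Matrix (Fin n) (Fin n) K) F) = diff H c x :=
    (diffFun_eq c x F hF).symm
  ext i j
  have hvanish : mulRightEntry Y i j - F * mulLeftEntry Y i j ∈ vanishing H :=
    mem_vanishing.2 fun t ht => by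
      rw [map_sub, map_mul, evalAt_mulRightEntry, evalAt_mulLeftEntry, ← hF ⟨t, ht⟩, hY ⟨t, ht⟩,
        Matrix.smul_apply, smul_eq_mul, sub_self]
  have hder := x.2 _ hvanish
  rw [map_sub, Derivation.leibniz, map_sub, map_add, smul_eq_mul, smul_eq_mul, map_mul, map_mul,
    hF_one, hF_diff, evalAt_one_invDer_mulRightEntry, evalAt_one_invDer_mulLeftEntry,
    evalAt_mulLeftEntry, Units.val_one, mul_one] at hder
  rw [Ring.lie_def, Matrix.sub_apply, Matrix.smul_apply, smul_eq_mul]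
  linear_combination hder

theorem mem_weightSpace {H T : Subgroup (GL (Fin n) K)} {c : Chars T} {x : lieAlg H} :
    x ∈ weightSpace H T c ↔ ∀ t : T, ((t : GL (Fin n) K) : Matrix (Fin n) (Fin n) K) * x =
      c.val t • (x * ((t : GL (Fin n) K) : Matrix (Fin n) (Fin n) K)) :=
  forall_congr' fun t => by
    rw [← smul_mul_assoc, Units.mul_inv_eq_iff_eq_mul]

theorem lie_mem_weightSpace {H T : Subgroup (GL (Fin n) K)} {α β : Chars T} {x y : lieAlg H}
    (hx : x ∈ weightSpace H T α) (hy : y ∈ weightSpace H T β) :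
    ⁅x, y⁆ ∈ weightSpace H T (α + β) := by
  rw [mem_weightSpace] at hx hy ⊢
  intro t
  rw [LieSubalgebra.coe_bracket, Ring.lie_def, mul_sub, sub_mul, ← mul_assoc, hx, ← mul_assoc, hy,
    smul_mul_assoc, smul_mul_assoc, mul_assoc, hy, mul_assoc, hx, mul_smul_comm, mul_smul_comm,
    smul_smul, smul_smul, Chars.val_add, mul_comm (β.val t), ← smul_sub, mul_assoc, mul_assoc]

theorem lieAlg_mono {H H' : Subgroup (GL (Fin n) K)} (h : H ≤ H') : lieAlg H ≤ lieAlg H' :=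
  fun _ hx f hf => hx f (mem_vanishing.2 fun g hg => mem_vanishing.1 hf g (h hg))

theorem roots_mono {H H' T : Subgroup (GL (Fin n) K)} (h : H ≤ H') : roots H T ⊆ roots H' T := by
  rintro α ⟨hα, hne⟩
  obtain ⟨x, hx, hx0⟩ := (Submodule.ne_bot_iff _).1 hne
  refine ⟨hα, (Submodule.ne_bot_iff _).2 ⟨⟨x, lieAlg_mono h x.2⟩, ?_, fun h0 => hx0 ?_⟩⟩
  · rw [mem_weightSpace] at hx ⊢
    exact hx
  · rw [Subtype.ext_iff, ZeroMemClass.coe_zero] at h0 ⊢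
    exact h0

end Differentials

theorem adjoin_range_ι (k L : Type*) [CommRing k] [LieRing L] [LieAlgebra k L] :
    Algebra.adjoin k (Set.range (UniversalEnvelopingAlgebra.ι k : L → _)) = ⊤ := by
  let S := Algebra.adjoin k (Set.range (UniversalEnvelopingAlgebra.ι k : L → _))
  let f : L →ₗ⁅k⁆ S :=
    { toFun := fun x => ⟨UniversalEnvelopingAlgebra.ι k x, Algebra.subset_adjoin ⟨x, rfl⟩⟩
      map_add' := fun x y => Subtype.ext (map_add (UniversalEnvelopingAlgebra.ι k) x y)
      map_smul' := fun r x => Subtype.ext (map_smul (UniversalEnvelopingAlgebra.ι k) r x)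
      map_lie' := fun {x y} => Subtype.ext ((UniversalEnvelopingAlgebra.ι k).map_lie x y) }
  let F := UniversalEnvelopingAlgebra.lift k f
  have hF : S.val.comp F = AlgHom.id k _ := UniversalEnvelopingAlgebra.hom_ext k <|
    LieHom.ext fun x => congrArg Subtype.val (UniversalEnvelopingAlgebra.lift_ι_apply k f x)
  refine eq_top_iff.2 fun u _ => ?_
  rw [← AlgHom.id_apply (R := k) u, ← hF]
  exact (F u).2

end LinAlg

namespace LeviDatum

open LinAlg

/-! ### Linear forms that vanish on root vectors and brackets -/

section Brackets

variable {K : Type u} [Field K] {n : ℕ} (D : LeviDatum K n)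

theorem Rpos_subset_R : D.Rpos ⊆ D.R := roots_mono D.borel.prop.1

theorem lie_h_e {α : D.X} (hα : α ∈ D.R) (x : D.h) : ⁅(x : D.g), D.e α⁆ = D.d α x • D.e α :=
  Subtype.ext (lie_eq_diff_smul α (mem_weightSpace.1 (D.e_mem α hα))
    ⟨((x : D.g) : Matrix (Fin n) (Fin n) K), x.2⟩)

theorem lie_h_h (x y : D.h) : ⁅(x : D.g), (y : D.g)⁆ = 0 :=
  congrArg Subtype.val (D.h_lie_eq_zero x y)

theorem g_induction {P : D.g → Prop} (h : ∀ x : D.h, P x) (e : ∀ α ∈ D.R, P (D.e α))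
    (add : ∀ x y, P x → P y → P (x + y)) (smul : ∀ (k : K) x, P x → P (k • x)) (x : D.g) :
    P x := by
  obtain ⟨s, hs, y, hy, rfl⟩ := Submodule.mem_sup.1
    (D.e_isCompl.sup_eq_top ▸ Submodule.mem_top :
      x ∈ Submodule.span K (D.e '' D.R) ⊔ (cartan D.G D.T).toSubmodule)
  refine add _ _ ?_ (h ⟨y, hy⟩)
  induction hs using Submodule.span_induction with
  | mem z hz => obtain ⟨α, hα, rfl⟩ := hz; exact e α hα
  | zero => exact h 0
  | add a b _ _ ha hb => exact add _ _ ha hb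
  | smul r a _ ha => exact smul _ _ ha

theorem exists_conj_mem_span_e (t : D.T) {s : D.g} (hs : s ∈ Submodule.span K (D.e '' D.R)) :
    ∃ s' ∈ Submodule.span K (D.e '' D.R),
      ((t : GL (Fin n) K) : Matrix (Fin n) (Fin n) K) * s =
        s' * ((t : GL (Fin n) K) : Matrix (Fin n) (Fin n) K) := by
  induction hs using Submodule.span_induction with
  | mem z hz =>
    obtain ⟨α, hα, rfl⟩ := hz
    exact ⟨α.val t • D.e α, Submodule.smul_mem _ _ (Submodule.subset_span ⟨α, hα, rfl⟩), by
      rw [mem_weightSpace.1 (D.e_mem α hα) t, SetLike.val_smul, smul_mul_assoc]⟩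
  | zero => exact ⟨0, zero_mem _, by simp⟩
  | add a b _ _ ha hb =>
    obtain ⟨a', ha', ha⟩ := ha
    obtain ⟨b', hb', hb⟩ := hb
    exact ⟨a' + b', add_mem ha' hb', by
      rw [AddMemClass.coe_add, AddMemClass.coe_add, mul_add, add_mul, ha, hb]⟩
  | smul r a _ ha =>
    obtain ⟨a', ha', ha⟩ := ha
    exact ⟨r • a', Submodule.smul_mem _ _ ha', by
      rw [SetLike.val_smul, SetLike.val_smul, mul_smul_comm, smul_mul_assoc, ha]⟩

theorem weightSpace_le_span_e {β : D.X} (hβ : β ≠ 0) :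
    weightSpace D.G D.T β ≤ Submodule.span K (D.e '' D.R) := by
  intro x hx
  obtain ⟨t, ht⟩ : ∃ t, β.val t ≠ 1 := by
    by_contra! h
    exact hβ (Chars.ext_val fun t => by rw [h t, Chars.val_zero])
  obtain ⟨s, hs, y, hy, rfl⟩ := Submodule.mem_sup.1
    (D.e_isCompl.sup_eq_top ▸ Submodule.mem_top :
      x ∈ Submodule.span K (D.e '' D.R) ⊔ (cartan D.G D.T).toSubmodule)
  obtain ⟨s', hs', hss'⟩ := D.exists_conj_mem_span_e t hs
  have hconj : s' + y = β.val t • (s + y) := Subtype.ext <| by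
    have hx' := mem_weightSpace.1 hx t
    rw [AddMemClass.coe_add, mul_add, hss', D.h_comm_torus hy t.2, ← add_mul, ← smul_mul_assoc,
      Units.mul_left_inj] at hx'
    exact hx'
  have hy_eq : (β.val t - 1) • y = s' - β.val t • s := by
    rw [sub_smul, one_smul, sub_eq_sub_iff_add_eq_add, ← smul_add, add_comm y, hconj.symm]
  have hy_mem : (β.val t - 1) • y ∈
      Submodule.span K (D.e '' D.R) ⊓ (cartan D.G D.T).toSubmodule :=
    ⟨hy_eq ▸ sub_mem hs' (Submodule.smul_mem _ _ hs), Submodule.smul_mem _ _ hy⟩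
  rw [D.e_isCompl.inf_eq_bot, Submodule.mem_bot, smul_eq_zero] at hy_mem
  rw [hy_mem.resolve_left (sub_ne_zero.2 ht), add_zero]
  exact hs

/-- Linear maps on `𝔤` along which a `U_χ`-action can be twisted to `x ↦ x + ε(x)`: those that
vanish on brackets, so that the action of `𝔤` stays a Lie action, and on root vectors, so that the
relations `e_α ^ p = χ(e_α) ^ p` persist. -/
structure IsTwistForm {V : Type*} [AddCommGroup V] [Module K V] (ε : D.g →ₗ[K] V) : Prop where
  map_lie : ∀ x y : D.g, ε ⁅x, y⁆ = 0
  map_e : ∀ α ∈ D.R, ε (D.e α) = 0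

variable {D} {V : Type*} [AddCommGroup V] [Module K V]

theorem IsTwistForm.neg {ε : D.g →ₗ[K] V} (hε : D.IsTwistForm ε) : D.IsTwistForm (-ε) where
  map_lie x y := by rw [LinearMap.neg_apply, hε.map_lie, neg_zero]
  map_e α hα := by rw [LinearMap.neg_apply, hε.map_e α hα, neg_zero]

theorem isTwistForm_of_span_e {ε : D.g →ₗ[K] V}
    (hspan : ∀ y ∈ Submodule.span K (D.e '' D.R), ε y = 0)
    (hcoroot : ∀ α ∈ D.R, -α ∈ D.R → ε ⁅D.e α, D.e (-α)⁆ = 0) : D.IsTwistForm ε := by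
  have he : ∀ α ∈ D.R, ε (D.e α) = 0 := fun α hα => hspan _ (Submodule.subset_span ⟨α, hα, rfl⟩)
  have hhe : ∀ (x : D.h), ∀ α ∈ D.R, ε ⁅(x : D.g), D.e α⁆ = 0 := fun x α hα => by
    rw [D.lie_h_e hα, map_smul, he α hα, smul_zero]
  have hee : ∀ α ∈ D.R, ∀ β ∈ D.R, ε ⁅D.e α, D.e β⁆ = 0 := fun α hα β hβ => by
    by_cases hαβ : α + β = 0
    · obtain rfl := eq_neg_of_add_eq_zero_right hαβ
      exact hcoroot α hα hβ
    · exact hspan _ (D.weightSpace_le_span_e hαβ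
        (lie_mem_weightSpace (D.e_mem α hα) (D.e_mem β hβ)))
  refine ⟨fun x y => ?_, he⟩
  induction x using D.g_induction with
  | add x x' hx hx' => rw [add_lie, map_add, hx, hx', add_zero]
  | smul k x hx => rw [smul_lie, map_smul, hx, smul_zero]
  | h x =>
    induction y using D.g_induction with
    | add y y' hy hy' => rw [lie_add, map_add, hy, hy', add_zero]
    | smul k y hy => rw [lie_smul, map_smul, hy, smul_zero]
    | h y => rw [D.lie_h_h, map_zero]
    | e β hβ => exact hhe x β hβ
  | e α hα =>
    induction y using D.g_induction with
    | add y y' hy hy' => rw [lie_add, map_add, hy, hy', add_zero]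
    | smul k y hy => rw [lie_smul, map_smul, hy, smul_zero]
    | h y => rw [← lie_skew, map_neg, hhe y α hα, neg_zero]
    | e β hβ => exact hee α hα β hβ

theorem exists_isTwistForm_extension (f : D.h →ₗ[K] V)
    (hf : ∀ (α : D.X) (hα : α ∈ D.R) (hα' : -α ∈ D.R),
      f ⟨⁅D.e α, D.e (-α)⁆, D.lie_e_mem_h hα hα'⟩ = 0) :
    ∃ ε : D.g →ₗ[K] V, D.IsTwistForm ε ∧ ∀ x : D.h, ε x = f x := by
  let ε : D.g →ₗ[K] V := f ∘ₗ Submodule.projectionOnto _ _ D.e_isCompl.symm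
  have hε_h : ∀ x : D.h, ε x = f x := fun x =>
    congrArg f (Submodule.projectionOnto_apply_left D.e_isCompl.symm x)
  refine ⟨ε, isTwistForm_of_span_e (fun y hy => ?_) (fun α hα hα' => ?_), hε_h⟩
  · exact (congrArg f (Submodule.projectionOnto_apply_right D.e_isCompl.symm ⟨y, hy⟩)).trans
      (map_zero f)
  · exact (hε_h ⟨_, D.lie_e_mem_h hα hα'⟩).trans (hf α hα hα')

end Brackets

/-! ### The enveloping algebra -/

section EnvelopingAlgebra

variable {K : Type u} [Field K] {n : ℕ} {D : LeviDatum K n} {p : ℕ}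

/-- The universal property of `U_χ`. -/
noncomputable def liftUχ {E : Type*} [Ring E] [Algebra K E] (f : D.g →ₗ⁅K⁆ E)
    (hf : ∀ α ∈ D.R, f (D.e α) ^ p = algebraMap K E (D.χ (D.e α) ^ p)) : D.Uχ p →ₐ[K] E :=
  RingQuot.liftAlgHom K ⟨UniversalEnvelopingAlgebra.lift K f, by
    rintro _ _ ⟨α, hα⟩
    rw [map_pow, UniversalEnvelopingAlgebra.lift_ι_apply, AlgHom.commutes, hf α hα]⟩

theorem liftUχ_gen {E : Type*} [Ring E] [Algebra K E] (f : D.g →ₗ⁅K⁆ E)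
    (hf : ∀ α ∈ D.R, f (D.e α) ^ p = algebraMap K E (D.χ (D.e α) ^ p)) (x : D.g) :
    liftUχ f hf (D.gen p x) = f x :=
  (RingQuot.liftAlgHom_mkAlgHom_apply K _ _ _).trans (UniversalEnvelopingAlgebra.lift_ι_apply K f x)

variable (D p) in
theorem adjoin_range_gen : Algebra.adjoin K (Set.range (D.gen p)) = ⊤ := by
  have hrange : Set.range (D.gen p) = RingQuot.mkAlgHom K (D.Rel p) ''
      Set.range (UniversalEnvelopingAlgebra.ι K) := by
    rw [← Set.range_comp]
    rfl
  rw [hrange, ← AlgHom.map_adjoin, adjoin_range_ι, Algebra.map_top,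
    (AlgHom.range_eq_top _).2 (RingQuot.mkAlgHom_surjective K _)]

@[elab_as_elim]
theorem Uχ_induction {P : D.Uχ p → Prop} (algebraMap : ∀ r : K, P (algebraMap K _ r))
    (gen : ∀ x, P (D.gen p x)) (add : ∀ a b, P a → P b → P (a + b))
    (mul : ∀ a b, P a → P b → P (a * b)) (u : D.Uχ p) : P u := by
  have hu : u ∈ Algebra.adjoin K (Set.range (D.gen p)) := D.adjoin_range_gen p ▸ trivial
  induction hu using Algebra.adjoin_induction with
  | mem x hx => obtain ⟨x, rfl⟩ := hx; exact gen x
  | algebraMap r => exact algebraMap r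
  | add a b _ _ ha hb => exact add a b ha hb
  | mul a b _ _ ha hb => exact mul a b ha hb

variable (D) in
/-- The group by which the objects of `𝒞_A` are graded: pairs of a class in `X / ℤI` and a weight
of `𝔥`. -/
abbrev Deg : Type u := D.Gr × Module.Dual K D.h

variable (D) in
/-- The degree `(μ + ℤI, dμ)` of a character `μ`. -/
noncomputable def deg : D.X →+ D.Deg := (QuotientAddGroup.mk' D.ZI).prod D.d

theorem deg_eq_iff {μ : D.X} {j : D.Deg} : D.deg μ = j ↔ D.cls μ = j.1 ∧ D.d μ = j.2 := Prod.ext_iff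

variable (D p) in
/-- `D.Word p u μ`: the element `u` of `U_χ` is a product of elements of `𝔥` and of root vectors
`e_α`, and `μ` is the sum of the roots `α` of the latter. -/
inductive Word : D.Uχ p → D.X → Prop
  | one : Word 1 0
  | h_mul (x : D.h) {u : D.Uχ p} {μ : D.X} : Word u μ → Word (D.gen p (x : D.g) * u) μ
  | e_mul (α : D.X) (hα : α ∈ D.R) {u : D.Uχ p} {μ : D.X} : Word u μ →
      Word (D.gen p (D.e α) * u) (α + μ)

variable (D p) in
/-- The span of the words of degree `j`. -/
noncomputable def wordSpan (j : D.Deg) : Submodule K (D.Uχ p) :=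
  Submodule.span K {u | ∃ μ, D.Word p u μ ∧ D.deg μ = j}

theorem Word.mem_wordSpan {u : D.Uχ p} {μ : D.X} (hu : D.Word p u μ) :
    u ∈ D.wordSpan p (D.deg μ) :=
  Submodule.subset_span ⟨μ, hu, rfl⟩

theorem Word.monomial {u : D.Uχ p} {μ : D.X} (hu : D.Word p u μ) : D.Monomial p u (D.cls μ) := by
  induction hu with
  | one => exact .one
  | h_mul x _ ih => exact .h_mul x ih
  | e_mul α hα _ ih => exact .e_mul α hα ih

theorem Monomial.exists_word {u : D.Uχ p} {c : D.Gr} (hu : D.Monomial p u c) :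
    ∃ μ, D.Word p u μ ∧ D.cls μ = c := by
  induction hu with
  | one => exact ⟨0, .one, rfl⟩
  | h_mul x _ ih =>
    obtain ⟨μ, hμ, rfl⟩ := ih
    exact ⟨μ, .h_mul x hμ, rfl⟩
  | e_mul α hα _ ih =>
    obtain ⟨μ, hμ, rfl⟩ := ih
    exact ⟨α + μ, .e_mul α hα hμ, rfl⟩

theorem grade_eq_iSup_wordSpan (c : D.Gr) : D.grade p c = ⨆ φ, D.wordSpan p (c, φ) := by
  refine le_antisymm (Submodule.span_le.2 fun u hu => ?_) (iSup_le fun φ => Submodule.span_mono ?_)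
  · obtain ⟨μ, hμ, rfl⟩ := Monomial.exists_word hu
    exact Submodule.mem_iSup_of_mem (D.d μ) hμ.mem_wordSpan
  · rintro u ⟨μ, hu, hμ⟩
    obtain ⟨rfl, -⟩ := deg_eq_iff.1 hμ
    exact hu.monomial

variable (D p) in
/-- The elements of `U_χ` of weight `φ` under the commutator action of `𝔥`. -/
noncomputable def adWeightSpace (φ : Module.Dual K D.h) : Submodule K (D.Uχ p) :=
  ⨅ x : D.h, (LieAlgebra.ad K (D.Uχ p) (D.gen p (x : D.g))).eigenspace (φ x)

theorem mem_adWeightSpace {φ : Module.Dual K D.h} {u : D.Uχ p} :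
    u ∈ D.adWeightSpace p φ ↔ ∀ x : D.h, ⁅D.gen p (x : D.g), u⁆ = φ x • u := by
  simp only [adWeightSpace, Submodule.mem_iInf, Module.End.mem_eigenspace_iff, LieAlgebra.ad_apply]

variable (D p) in
theorem iSupIndep_adWeightSpace : iSupIndep (D.adWeightSpace p) := by
  have hcomm : ∀ x y : D.h, Commute (LieAlgebra.ad K (D.Uχ p) (D.gen p (x : D.g)))
      (LieAlgebra.ad K (D.Uχ p) (D.gen p (y : D.g))) := fun x y => by
    rw [commute_iff_lie_eq, ← LieHom.map_lie, ← LieHom.map_lie, D.lie_h_h, map_zero, map_zero]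
  have hind := Module.End.independent_iInf_maxGenEigenspace_of_forall_mapsTo
    (fun x : D.h => LieAlgebra.ad K (D.Uχ p) (D.gen p (x : D.g)))
    fun x y => Module.End.mapsTo_maxGenEigenspace_of_comm (hcomm y x)
  exact (hind.comp (f := fun φ : Module.Dual K D.h => ⇑φ) DFunLike.coe_injective).mono
    fun φ => iInf_mono fun x => Module.End.eigenspace_le_maxGenEigenspace

theorem Word.lie_gen_h {u : D.Uχ p} {μ : D.X} (hu : D.Word p u μ) (x : D.h) :
    ⁅D.gen p (x : D.g), u⁆ = D.d μ x • u := by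
  have hleibniz : ∀ a b c : D.Uχ p, ⁅a, b * c⁆ = ⁅a, b⁆ * c + b * ⁅a, c⁆ := fun a b c => by
    simp only [Ring.lie_def]
    noncomm_ring
  induction hu with
  | one => simp [Ring.lie_def]
  | h_mul y _ ih =>
    rw [hleibniz, ih, ← LieHom.map_lie, D.lie_h_h, map_zero, zero_mul, zero_add, mul_smul_comm]
  | e_mul α hα _ ih =>
    rw [hleibniz, ih, ← LieHom.map_lie, D.lie_h_e hα, map_smul, smul_mul_assoc, mul_smul_comm,
      ← add_smul, map_add, LinearMap.add_apply]

theorem wordSpan_le_adWeightSpace (j : D.Deg) : D.wordSpan p j ≤ D.adWeightSpace p j.2 := by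
  refine Submodule.span_le.2 ?_
  rintro u ⟨μ, hu, hμ⟩
  exact mem_adWeightSpace.2 fun x => (deg_eq_iff.1 hμ).2 ▸ hu.lie_gen_h x

theorem gradeWeight_eq_wordSpan (j : D.Deg) : D.gradeWeight p j.1 j.2 = D.wordSpan p j := by
  have hinf : D.gradeWeight p j.1 j.2 = D.adWeightSpace p j.2 ⊓ D.grade p j.1 :=
    Submodule.ext fun u => (and_congr_right fun _ => mem_adWeightSpace.symm).trans and_comm
  rw [hinf, grade_eq_iSup_wordSpan]
  exact inf_iSup_eq_of_iSupIndep (D.iSupIndep_adWeightSpace p)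
    (fun φ => wordSpan_le_adWeightSpace (j.1, φ)) j.2

end EnvelopingAlgebra

/-! ### Weight modules -/

section Objects

variable {K : Type u} [Field K] {n : ℕ} {D : LeviDatum K n} {p : ℕ}
  {A : Type v} [CommRing A] [Algebra K A] {M N : D.PreObj p A}

namespace PreObj

variable (M) in
/-- The piece `M_c^φ` of `M`, indexed by the degree `j = (c, φ)`. -/
def degPiece (j : D.Deg) : Submodule A M.carrier := M.piece j.1 j.2

theorem smul_mem_of_gen_smul_mem {P : Submodule A M.carrier}
    (hP : ∀ x, ∀ m ∈ P, D.gen p x • m ∈ P) (u : D.Uχ p) {m : M.carrier} (hm : m ∈ P) :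
    u • m ∈ P := by
  induction u using Uχ_induction generalizing m with
  | algebraMap r => exact M.algebraMap_smul r m ▸ P.smul_mem _ hm
  | gen x => exact hP x m hm
  | add a b ha hb => exact add_smul a b m ▸ P.add_mem (ha hm) (hb hm)
  | mul a b ha hb => exact mul_smul a b m ▸ ha (hb hm)

theorem map_smul_of_map_gen_smul {f : M.carrier →ₗ[A] N.carrier}
    (hf : ∀ x m, f (D.gen p x • m) = D.gen p x • f m) (u : D.Uχ p) (m : M.carrier) :
    f (u • m) = u • f m := by
  induction u using Uχ_induction generalizing m with
  | algebraMap r => rw [M.algebraMap_smul, N.algebraMap_smul, map_smul]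
  | gen x => exact hf x m
  | add a b ha hb => rw [add_smul, add_smul, map_add, ha, hb]
  | mul a b ha hb => rw [mul_smul, mul_smul, ha, hb]

/-- The conditions on an object of `𝒞_A` apart from finiteness and the independence of the pieces,
expressed by the action of the generators of `U_χ` only. -/
structure IsWeightModule (π : D.U0 →ₐ[K] A) (M : D.PreObj p A) : Prop where
  iSup_eq_top : ⨆ j, M.degPiece j = ⊤
  weights : ∀ j, M.degPiece j ≠ ⊥ → ∃ μ τ : D.X, D.cls (μ + p • τ) = j.1 ∧ D.d μ = j.2
  h_smul : ∀ (x : D.h) (j : D.Deg), ∀ m ∈ M.degPiece j, D.gen p (x : D.g) • m =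
    (π (UniversalEnvelopingAlgebra.ι K x) + algebraMap K A (j.2 x)) • m
  e_smul : ∀ α ∈ D.R, ∀ j, ∀ m ∈ M.degPiece j, D.gen p (D.e α) • m ∈ M.degPiece (D.deg α + j)

end PreObj

theorem ofU0_ι (x : D.h) : D.ofU0 p (UniversalEnvelopingAlgebra.ι K x) = D.gen p (x : D.g) :=
  UniversalEnvelopingAlgebra.lift_ι_apply K _ x

theorem shift_ι (φ : Module.Dual K D.h) (x : D.h) :
    D.shift φ (UniversalEnvelopingAlgebra.ι K x) =
      UniversalEnvelopingAlgebra.ι K x + algebraMap K D.U0 (φ x) :=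
  UniversalEnvelopingAlgebra.lift_ι_apply K _ x

theorem ofU0_smul_of_h_smul {W : Type*} [AddCommGroup W] [Module (D.Uχ p) W] [Module A W]
    [SMulCommClass (D.Uχ p) A W]
    (hK : ∀ (k : K) (w : W), algebraMap K (D.Uχ p) k • w = algebraMap K A k • w)
    {π : D.U0 →ₐ[K] A} {φ : Module.Dual K D.h} {w : W}
    (hw : ∀ x : D.h, D.gen p (x : D.g) • w =
      (π (UniversalEnvelopingAlgebra.ι K x) + algebraMap K A (φ x)) • w) (s : D.U0) :
    D.ofU0 p s • w = π (D.shift φ s) • w := by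
  have hs : s ∈ Algebra.adjoin K (Set.range (UniversalEnvelopingAlgebra.ι K)) :=
    adjoin_range_ι K D.h ▸ trivial
  induction hs using Algebra.adjoin_induction with
  | mem s hs =>
    obtain ⟨x, rfl⟩ := hs
    rw [ofU0_ι, shift_ι, map_add, AlgHom.commutes, hw]
  | algebraMap r => simp only [AlgHom.commutes, hK]
  | add s t _ _ hs ht => simp only [map_add, add_smul, hs, ht]
  | mul s t _ _ hs ht =>
    rw [map_mul, mul_smul, ht, smul_comm, hs, smul_smul, map_mul, map_mul, mul_comm]

namespace PreObj.IsWeightModule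

variable {π : D.U0 →ₐ[K] A}

theorem word_smul (hM : M.IsWeightModule π) {u : D.Uχ p} {μ : D.X} (hu : D.Word p u μ) {j : D.Deg}
    {m : M.carrier} (hm : m ∈ M.degPiece j) : u • m ∈ M.degPiece (D.deg μ + j) := by
  induction hu with
  | one => rwa [one_smul, map_zero, zero_add]
  | h_mul x _ ih =>
    rw [mul_smul, hM.h_smul x _ _ ih]
    exact Submodule.smul_mem _ _ ih
  | e_mul α hα _ ih =>
    rw [mul_smul, map_add, add_assoc]
    exact hM.e_smul α hα _ _ ih

theorem smul_gradePiece (hM : M.IsWeightModule π) {b c : D.Gr} {u : D.Uχ p}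
    (hu : u ∈ D.grade p b) {m : M.carrier} (hm : m ∈ M.gradePiece c) :
    u • m ∈ M.gradePiece (b + c) := by
  have hword : ∀ {w μ}, D.Word p w μ → w • m ∈ M.gradePiece (D.cls μ + c) := by
    intro w μ hw
    induction hm using Submodule.iSup_induction' with
    | mem φ m hm =>
      exact Submodule.mem_iSup_of_mem (D.d μ + φ) (hM.word_smul hw (j := (c, φ)) hm)
    | zero => exact (smul_zero (A := M.carrier) w).symm ▸ zero_mem _
    | add m m' _ _ ih ih' => exact smul_add w m m' ▸ add_mem ih ih'
  induction hu using Submodule.span_induction with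
  | mem w hw =>
    obtain ⟨μ, hμ, rfl⟩ := Monomial.exists_word hw
    exact hword hμ
  | zero => exact zero_smul (D.Uχ p) m ▸ zero_mem _
  | add w w' _ _ ih ih' => exact add_smul w w' m ▸ add_mem ih ih'
  | smul r w _ ih =>
    rw [Algebra.smul_def, mul_smul, M.algebraMap_smul]
    exact Submodule.smul_mem _ _ ih

theorem ofU0_smul (hM : M.IsWeightModule π) (s : D.U0) {j : D.Deg} {m : M.carrier}
    (hm : m ∈ M.degPiece j) : D.ofU0 p s • m = π (D.shift j.2 s) • m :=
  ofU0_smul_of_h_smul M.algebraMap_smul (fun x => hM.h_smul x j m hm) s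

end PreObj.IsWeightModule

theorem PreObj.IsObj.isWeightModule {π : D.U0 →ₐ[K] A} (hM : M.IsObj π) : M.IsWeightModule π where
  iSup_eq_top := hM.iSup_eq_top
  weights j := hM.weights j.1 j.2
  h_smul x j m hm := by
    rw [← ofU0_ι, hM.U0_smul _ _ _ m hm, shift_ι, map_add, AlgHom.commutes]
  e_smul α hα j m hm := by
    have := hM.e_smul α hα j.1 j.2 m hm
    rwa [add_comm j.2] at this

theorem PreObj.IsObj.finite_carrier {π : D.U0 →ₐ[K] A} (hM : M.IsObj π) :
    Module.Finite A M.carrier := by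
  have htop : ⨆ c ∈ hM.finite.toFinset, M.gradePiece c = ⊤ := by
    refine eq_top_iff.2 (hM.iSup_eq_top ▸ iSup_le fun j => (le_iSup (M.piece j.1) j.2).trans ?_)
    by_cases hj : M.gradePiece j.1 = ⊥
    · exact hj.trans_le bot_le
    · exact le_biSup M.gradePiece (hM.finite.mem_toFinset.2 hj)
  exact ⟨htop ▸ Submodule.fg_biSup _ _ fun c _ => hM.fg c⟩

theorem PreObj.isObj_iff [IsNoetherianRing A] {π : D.U0 →ₐ[K] A} :
    M.IsObj π ↔ M.IsWeightModule π ∧ iSupIndep M.degPiece ∧ Module.Finite A M.carrier := by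
  refine ⟨fun hM => ⟨hM.isWeightModule, hM.indep, hM.finite_carrier⟩, fun ⟨hM, hind, _⟩ =>
    { indep := hind
      iSup_eq_top := hM.iSup_eq_top
      weights := fun c φ => hM.weights (c, φ)
      finite := ?_
      fg := fun c => IsNoetherian.noetherian _
      grade_smul := fun b c u hu m hm => hM.smul_gradePiece hu hm
      U0_smul := fun c φ s m hm => hM.ofU0_smul s (j := (c, φ)) hm
      e_smul := fun α hα c φ m hm => ?_ }⟩
  · refine ((WellFoundedGT.finite_ne_bot_of_iSupIndep hind).image Prod.fst).subset fun c hc => ?_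
    obtain ⟨φ, hφ⟩ : ∃ φ, M.piece c φ ≠ ⊥ := by
      by_contra! h
      exact hc (iSup_eq_bot.2 h)
    exact ⟨(c, φ), hφ, rfl⟩
  · exact add_comm φ (D.d α) ▸ hM.e_smul α hα (c, φ) m hm

end Objects

/-! ### Twisting -/

section Twist

variable {K : Type u} [Field K] {n : ℕ} {D : LeviDatum K n} {p : ℕ}
  {A : Type v} [CommRing A] [Algebra K A] {M N M' N' : D.PreObj p A}

theorem gen_e_pow {α : D.X} (hα : α ∈ D.R) :
    D.gen p (D.e α) ^ p = algebraMap K (D.Uχ p) (D.χ (D.e α) ^ p) := by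
  have hrel := RingQuot.mkAlgHom_rel K (Rel.pow (p := p) α hα)
  rwa [map_pow, AlgHom.commutes] at hrel

variable (D) in
/-- `ε` is a twist form that carries the structure map `π` to `π'`: `π' = π + ε` on `𝔥`. -/
structure IsTwist (ε : D.g →ₗ[K] A) (π π' : D.U0 →ₐ[K] A) : Prop extends D.IsTwistForm ε where
  map_h : ∀ x : D.h,
    π' (UniversalEnvelopingAlgebra.ι K x) = π (UniversalEnvelopingAlgebra.ι K x) + ε x

theorem IsTwist.neg {ε : D.g →ₗ[K] A} {π π' : D.U0 →ₐ[K] A} (hε : D.IsTwist ε π π') :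
    D.IsTwist (-ε) π' π where
  toIsTwistForm := hε.toIsTwistForm.neg
  map_h x := by rw [hε.map_h, LinearMap.neg_apply, add_neg_cancel_right]

namespace PreObj

/-- A map of `A`-modules that commutes with `𝔤` and preserves the pieces, as a morphism. -/
def Mor.ofGen (f : M.carrier →ₗ[A] N.carrier)
    (hgen : ∀ x m, f (D.gen p x • m) = D.gen p x • f m)
    (hpiece : ∀ j, ∀ m ∈ M.degPiece j, f m ∈ N.degPiece j) : M.Mor N where
  toFun := f
  map_smulU := map_smul_of_map_gen_smul hgen
  map_piece c φ := hpiece (c, φ)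

theorem Mor.map_degPiece (f : M.Mor N) {j : D.Deg} {m : M.carrier} (hm : m ∈ M.degPiece j) :
    f.toFun m ∈ N.degPiece j :=
  f.map_piece j.1 j.2 m hm

variable (M) in
/-- The representation of `U_χ` on `M` in which `x ∈ 𝔤` acts as it does on `M` plus the
scalar `ε x`. -/
noncomputable def twistHom {ε : D.g →ₗ[K] A} (hε : D.IsTwistForm ε) :
    D.Uχ p →+* Module.End A M.carrier :=
  letI := Algebra.compHom (Module.End A M.carrier) (algebraMap K A)
  letI ρ : D.Uχ p →ₐ[K] Module.End A M.carrier :=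
    { (Module.toModuleEnd A M.carrier : D.Uχ p →+* Module.End A M.carrier) with
      commutes' := fun k => LinearMap.ext (M.algebraMap_smul k) }
  (liftUχ (D := D) (p := p)
    { toFun := fun x => ρ (D.gen p x) + algebraMap A (Module.End A M.carrier) (ε x)
      map_add' := fun x y => by simp only [map_add]; abel
      map_smul' := fun r x => by
        rw [map_smul, map_smul, map_smul, RingHom.id_apply, smul_add, Algebra.smul_def r (ε x),
          map_mul]
        rfl
      map_lie' := fun {x y} => by
        have hcomm (a : A) (f : Module.End A M.carrier) :
            ⁅f, algebraMap A (Module.End A M.carrier) a⁆ = 0 := by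
          rw [Ring.lie_def, Algebra.commutes, sub_self]
        rw [hε.map_lie, map_zero, add_zero, LieHom.map_lie, add_lie, lie_add, lie_add, hcomm, hcomm,
          add_zero, ← lie_skew (algebraMap A _ (ε x)), hcomm, neg_zero, add_zero,
          add_zero]
        exact LieHom.map_lie (ρ : D.Uχ p →ₗ⁅K⁆ Module.End A M.carrier) _ _ }
    fun α hα => by
      change (ρ _ + algebraMap A _ (ε _)) ^ p = _
      rw [hε.map_e α hα, map_zero, add_zero, ← map_pow, gen_e_pow hα, AlgHom.commutes]).toRingHom

theorem twistHom_gen {ε : D.g →ₗ[K] A} (hε : D.IsTwistForm ε) (x : D.g) (m : M.carrier) :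
    M.twistHom hε (D.gen p x) m = D.gen p x • m + ε x • m :=
  letI := Algebra.compHom (Module.End A M.carrier) (algebraMap K A)
  LinearMap.congr_fun (liftUχ_gen _ _ x) m

theorem twistHom_algebraMap {ε : D.g →ₗ[K] A} (hε : D.IsTwistForm ε) (k : K) (m : M.carrier) :
    M.twistHom hε (algebraMap K _ k) m = algebraMap K A k • m :=
  letI := Algebra.compHom (Module.End A M.carrier) (algebraMap K A)
  LinearMap.congr_fun (AlgHom.commutes (liftUχ _ _) k) m

variable (M) in
/-- `M` with the action of `x ∈ 𝔤` changed by the scalar `ε x`. -/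
noncomputable def twist {ε : D.g →ₗ[K] A} (hε : D.IsTwistForm ε) : D.PreObj p A where
  carrier := M.carrier
  moduleU := Module.compHom M.carrier (M.twistHom hε)
  smulCommClass :=
    letI := Module.compHom M.carrier (M.twistHom hε)
    ⟨fun u a m => map_smul (M.twistHom hε u) a m⟩
  algebraMap_smul := twistHom_algebraMap hε
  piece := M.piece

/-- An isomorphism of `A`-modules that matches the pieces of `M` and `M'` and transforms the action
of `x ∈ 𝔤` on `M` plus the scalar `ε x` into the action of `x` on `M'`. -/
structure TwistIso (ε : D.g →ₗ[K] A) (M M' : D.PreObj p A) where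
  toEquiv : M.carrier ≃ₗ[A] M'.carrier
  map_gen_smul : ∀ x m, D.gen p x • toEquiv m = toEquiv (D.gen p x • m) + ε x • toEquiv m
  map_degPiece : ∀ j, (M.degPiece j).map (toEquiv : M.carrier →ₗ[A] M'.carrier) = M'.degPiece j

variable (M) in
/-- The identity map as an isomorphism from `M` to its twist. -/
noncomputable def toTwist {ε : D.g →ₗ[K] A} (hε : D.IsTwistForm ε) : TwistIso ε M (M.twist hε) where
  toEquiv := LinearEquiv.refl A M.carrier
  map_gen_smul := twistHom_gen hε
  map_degPiece _ := Submodule.map_id _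

namespace TwistIso

variable {ε : D.g →ₗ[K] A}

/-- The inverse isomorphism. -/
def symm (f : TwistIso ε M M') : TwistIso (-ε) M' M where
  toEquiv := f.toEquiv.symm
  map_gen_smul x m := f.toEquiv.injective <| by
    rw [LinearMap.neg_apply, neg_smul, ← sub_eq_add_neg, map_sub, f.toEquiv.map_smul (ε x),
      LinearEquiv.apply_symm_apply, LinearEquiv.apply_symm_apply, eq_sub_iff_add_eq]
    simpa only [LinearEquiv.apply_symm_apply] using (f.map_gen_smul x (f.toEquiv.symm m)).symm
  map_degPiece j := by
    rw [← f.map_degPiece, ← Submodule.map_comp, LinearEquiv.comp_coe, LinearEquiv.self_trans_symm]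
    exact Submodule.map_id _

theorem mem_degPiece (f : TwistIso ε M M') {j : D.Deg} {m : M.carrier} (hm : m ∈ M.degPiece j) :
    f.toEquiv m ∈ M'.degPiece j :=
  f.map_degPiece j ▸ Submodule.mem_map_of_mem hm

theorem iSupIndep_degPiece (f : TwistIso ε M M') (hM : iSupIndep M.degPiece) :
    iSupIndep M'.degPiece :=
  funext f.map_degPiece ▸ LinearMap.iSupIndep_map _ f.toEquiv.injective hM

theorem isWeightModule (f : TwistIso ε M M') {π π' : D.U0 →ₐ[K] A}
    (hε : D.IsTwist ε π π') (hM : M.IsWeightModule π) : M'.IsWeightModule π' where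
  iSup_eq_top := by
    simp only [← f.map_degPiece]
    rw [← Submodule.map_iSup, hM.iSup_eq_top, Submodule.map_top, LinearEquiv.range]
  weights j hj := hM.weights j fun h => hj (by rw [← f.map_degPiece, h, Submodule.map_bot])
  h_smul x j m' hm' := by
    rw [← f.map_degPiece] at hm'
    obtain ⟨m, hm, rfl⟩ := hm'
    refine (f.map_gen_smul x m).trans ?_
    rw [hM.h_smul x j m hm, map_smul, ← add_smul, hε.map_h, add_right_comm]
    rfl
  e_smul α hα j m' hm' := by
    rw [← f.map_degPiece] at hm'
    obtain ⟨m, hm, rfl⟩ := hm'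
    have := f.mem_degPiece (hM.e_smul α hα j m hm)
    rwa [← add_zero (f.toEquiv _), ← zero_smul A (f.toEquiv m), ← hε.map_e α hα,
      ← f.map_gen_smul] at this

theorem isObj (f : TwistIso ε M M') [IsNoetherianRing A] {π π' : D.U0 →ₐ[K] A}
    (hε : D.IsTwist ε π π') (hM : M.IsObj π) : M'.IsObj π' := by
  obtain ⟨hM, hind, _⟩ := isObj_iff.1 hM
  exact isObj_iff.2 ⟨f.isWeightModule hε hM, f.iSupIndep_degPiece hind,
    Module.Finite.equiv f.toEquiv⟩

/-- The morphism that corresponds to a morphism between the untwisted objects. -/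
def conj (f : TwistIso ε M M') (g : TwistIso ε N N') (h : M.Mor N) : M'.Mor N' :=
  .ofGen (g.toEquiv.toLinearMap ∘ₗ h.toFun ∘ₗ f.toEquiv.symm.toLinearMap)
    (fun x m' => by
      obtain ⟨m, rfl⟩ := f.toEquiv.surjective m'
      rw [f.map_gen_smul]
      simp [g.map_gen_smul, h.map_smulU])
    fun j m' hm' => g.mem_degPiece (h.map_degPiece (f.symm.mem_degPiece hm'))

end TwistIso

/-- `Hom(M, N) ≠ 0`. -/
def NonzeroHom (M N : D.PreObj p A) : Prop := ∃ f : M.Mor N, f.toFun ≠ 0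

/-- `Ext¹(M, N) ≠ 0` in `𝒞_A`: some short exact sequence `0 → N → E → M → 0` does not split. -/
def NonsplitExt (π : D.U0 →ₐ[K] A) (M N : D.PreObj p A) : Prop :=
  ∃ (E : D.PreObj p A) (_ : E.IsObj π) (i : N.Mor E) (q : E.Mor M),
    Function.Injective i.toFun ∧ LinearMap.range i.toFun = LinearMap.ker q.toFun ∧
    Function.Surjective q.toFun ∧ ¬ ∃ s : M.Mor E, q.toFun ∘ₗ s.toFun = LinearMap.id

namespace TwistIso

variable {ε : D.g →ₗ[K] A}

theorem nonzeroHom (f : TwistIso ε M M') (g : TwistIso ε N N') (h : NonzeroHom M N) :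
    NonzeroHom M' N' := by
  obtain ⟨h, hh⟩ := h
  refine ⟨f.conj g h, fun h0 => hh (LinearMap.ext fun m => g.toEquiv.injective ?_)⟩
  simpa [conj, Mor.ofGen] using LinearMap.congr_fun h0 (f.toEquiv m)

theorem nonzeroHom_iff (f : TwistIso ε M M') (g : TwistIso ε N N') :
    NonzeroHom M N ↔ NonzeroHom M' N' :=
  ⟨f.nonzeroHom g, f.symm.nonzeroHom g.symm⟩

theorem nonsplitExt [IsNoetherianRing A] (f : TwistIso ε M M') (g : TwistIso ε N N')
    {π π' : D.U0 →ₐ[K] A} (hε : D.IsTwist ε π π') (h : NonsplitExt π M N) :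
    NonsplitExt π' M' N' := by
  obtain ⟨E, hE, i, q, hi, hiq, hq, hsplit⟩ := h
  let t := E.toTwist hε.toIsTwistForm
  refine ⟨E.twist hε.toIsTwistForm, t.isObj hε hE, g.conj t i, t.conj f q, ?_, ?_, ?_,
    fun ⟨s, hs⟩ => ?_⟩
  · exact t.toEquiv.injective.comp (hi.comp g.toEquiv.symm.injective)
  · refine (LinearMap.exact_iff.1 (Function.Exact.of_ladder_linearEquiv_of_exact
      (e₁ := g.toEquiv) (e₂ := t.toEquiv) (e₃ := f.toEquiv) ?_ ?_
      (LinearMap.exact_iff.2 hiq.symm))).symm <;> ext <;> simp [conj, Mor.ofGen]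
  · exact f.toEquiv.surjective.comp (hq.comp t.toEquiv.symm.surjective)
  · refine hsplit ⟨f.symm.conj t.symm s, LinearMap.ext fun m => f.toEquiv.injective ?_⟩
    simpa [conj, Mor.ofGen, symm] using LinearMap.congr_fun hs (f.toEquiv m)

theorem nonsplitExt_iff [IsNoetherianRing A] (f : TwistIso ε M M') (g : TwistIso ε N N')
    {π π' : D.U0 →ₐ[K] A} (hε : D.IsTwist ε π π') :
    NonsplitExt π M N ↔ NonsplitExt π' M' N' :=
  ⟨f.nonsplitExt g hε, f.symm.nonsplitExt g.symm hε.neg⟩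

end TwistIso

end PreObj

end Twist

/-! ### Base change -/

section BaseChange

variable {K : Type u} [Field K] {n : ℕ} {D : LeviDatum K n} {p : ℕ}
  {A : Type v} [CommRing A] [Algebra K A] {M N : D.PreObj p K}

namespace PreObj

variable (A M) in
/-- The base change `A ⊗ M` of a `U_χ`-module `M`. -/
noncomputable def baseChange : D.PreObj p A where
  carrier := A ⊗[K] M.carrier
  moduleU := Module.compHom _ ((Module.End.baseChangeHom K A M.carrier).toRingHom.comp
    (Module.toModuleEnd K M.carrier))
  smulCommClass :=
    letI := Module.compHom (A ⊗[K] M.carrier)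
      ((Module.End.baseChangeHom K A M.carrier).toRingHom.comp
        (Module.toModuleEnd K M.carrier : D.Uχ p →+* Module.End K M.carrier))
    ⟨fun u a z => map_smul ((Module.toModuleEnd K M.carrier u).baseChange A) a z⟩
  algebraMap_smul k z := by
    change (Module.toModuleEnd K M.carrier (algebraMap K (D.Uχ p) k)).baseChange A z = _
    have hk : Module.toModuleEnd K M.carrier (algebraMap K (D.Uχ p) k) =
      algebraMap K (Module.End K M.carrier) k := LinearMap.ext (M.algebraMap_smul k)
    rw [hk, _root_.algebraMap_smul]
    induction z using TensorProduct.induction_on <;> simp_all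
  piece c φ := (M.piece c φ).baseChange A

theorem slice_smul (σ : Module.Dual K A) (u : D.Uχ p) (z : (M.baseChange A).carrier) :
    slice σ (u • z : (M.baseChange A).carrier) = u • (slice σ z : M.carrier) :=
  slice_baseChange σ (Module.toModuleEnd K M.carrier u) z

theorem IsWeightModule.baseChange {ρ : D.U0 →ₐ[K] K} (hM : M.IsWeightModule ρ) :
    (M.baseChange A).IsWeightModule ((Algebra.ofId K A).comp ρ) where
  iSup_eq_top := by
    have htop := congrArg (Submodule.baseChange A) hM.iSup_eq_top
    rwa [baseChange_iSup, Submodule.baseChange_top] at htop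
  weights j hj := hM.weights j fun h =>
    hj ((congrArg (Submodule.baseChange A) h).trans (Submodule.baseChange_bot A))
  h_smul x j z hz := by
    refine (baseChange_eq_smul_of_mem_baseChange (hM.h_smul x j) hz).trans ?_
    rw [map_add]
    rfl
  e_smul α hα j z hz := baseChange_mem_baseChange (hM.e_smul α hα j) hz

theorem isObj_baseChange_iff [IsNoetherianRing A] [Nontrivial A] {ρ : D.U0 →ₐ[K] K}
    (hM : M.IsWeightModule ρ) :
    (M.baseChange A).IsObj ((Algebra.ofId K A).comp ρ) ↔ M.IsObj ρ := by
  simp only [isObj_iff, hM, hM.baseChange, true_and]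
  refine and_congr ⟨iSupIndep_of_baseChange, iSupIndep_baseChange⟩ ⟨fun h => ?_, fun h => ?_⟩
  · have : Module.Finite A (A ⊗[K] M.carrier) := h
    exact .of_finite_tensorProduct_of_faithfullyFlat A
  · exact Module.Finite.base_change K A M.carrier

/-- The base change of a morphism. -/
noncomputable def Mor.baseChange (f : M.Mor N) : (M.baseChange A).Mor (N.baseChange A) where
  toFun := f.toFun.baseChange A
  map_smulU u z := by
    have hf : f.toFun ∘ₗ Module.toModuleEnd K M.carrier u =
        Module.toModuleEnd K N.carrier u ∘ₗ f.toFun := LinearMap.ext (f.map_smulU u)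
    have := congrArg (LinearMap.baseChange A) hf
    rw [LinearMap.baseChange_comp, LinearMap.baseChange_comp] at this
    exact LinearMap.congr_fun this z
  map_piece c φ _ hz := baseChange_mem_baseChange (f.map_piece c φ) hz

/-- The slice of a morphism between base changes. -/
noncomputable def Mor.slice (f : (M.baseChange A).Mor (N.baseChange A)) (σ : Module.Dual K A) :
    M.Mor N where
  toFun := sliceHom σ f.toFun
  map_smulU u m := (congrArg (LinAlg.slice σ) (f.map_smulU u (1 ⊗ₜ[K] m))).trans (slice_smul σ u _)
  map_piece c φ _ hm := slice_mem_of_mem_baseChange σ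
    (f.map_piece c φ _ (Submodule.tmul_mem_baseChange_of_mem 1 hm))

theorem nonzeroHom_baseChange_iff [Nontrivial A] :
    NonzeroHom (M.baseChange A) (N.baseChange A) ↔ NonzeroHom M N := by
  refine ⟨fun ⟨f, hf⟩ => ?_, fun ⟨f, hf⟩ => ⟨f.baseChange, fun h => hf ?_⟩⟩
  · by_contra! h
    exact hf (eq_zero_of_forall_sliceHom_eq_zero fun σ => by_contra fun hσ => h ⟨f.slice σ, hσ⟩)
  · obtain ⟨σ, hσ⟩ :=
      exists_sliceHom_baseChange_eq (K := K) (A := A) (V := M.carrier) (W := N.carrier)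
    rw [← hσ f.toFun, show f.toFun.baseChange A = 0 from h]
    ext m
    simp [sliceHom_apply]

end PreObj

end BaseChange

/-! ### Extensions and cocycles -/

section Cocycles

variable {K : Type u} [Field K] {n : ℕ} {D : LeviDatum K n} {p : ℕ}
  {A : Type v} [CommRing A] [Algebra K A] {M N : D.PreObj p A}

theorem PreObj.Mor.mem_degPiece_of_injective {E : D.PreObj p A} (i : N.Mor E)
    (hi : Function.Injective i.toFun) (hN : ⨆ j, N.degPiece j = ⊤) (hE : iSupIndep E.degPiece)
    {j : D.Deg} {z : N.carrier} (hz : i.toFun z ∈ E.degPiece j) : z ∈ N.degPiece j := by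
  rw [eq_of_le_of_iSup_eq_top (iSupIndep_comap hE hi) (fun _ _ hz => i.map_degPiece hz) hN]
  exact hz

/-- A derivation `κ : U_χ → Hom_A(M, N)` that vanishes on `𝔥` and has degree zero: the deviation
from `U_χ`-linearity of a graded `A`-linear section of an extension of `M` by `N`. -/
structure Cocycle (M N : D.PreObj p A) where
  toFun : D.Uχ p →+ (M.carrier →ₗ[A] N.carrier)
  map_algebraMap : ∀ k : K, toFun (algebraMap K (D.Uχ p) k) = 0
  map_mul : ∀ u v m, toFun (u * v) m = toFun u (v • m) + u • toFun v m
  map_h : ∀ x : D.h, toFun (D.gen p (x : D.g)) = 0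
  map_e : ∀ α ∈ D.R, ∀ j, ∀ m ∈ M.degPiece j,
    toFun (D.gen p (D.e α)) m ∈ N.degPiece (D.deg α + j)

namespace Cocycle

/-- `κ` is the deviation from `U_χ`-linearity of a graded map `M → N`. -/
def IsCoboundary (κ : Cocycle M N) : Prop :=
  ∃ w : M.carrier →ₗ[A] N.carrier, (∀ j, ∀ m ∈ M.degPiece j, w m ∈ N.degPiece j) ∧
    ∀ u m, κ.toFun u m = w (u • m) - u • w m

theorem eq_sub_of_gen (κ : Cocycle M N) {w : M.carrier →ₗ[A] N.carrier}
    (hw : ∀ x m, κ.toFun (D.gen p x) m = w (D.gen p x • m) - D.gen p x • w m) (u : D.Uχ p)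
    (m : M.carrier) : κ.toFun u m = w (u • m) - u • w m := by
  induction u using Uχ_induction generalizing m with
  | algebraMap r =>
    rw [κ.map_algebraMap, M.algebraMap_smul, N.algebraMap_smul, map_smul, sub_self,
      LinearMap.zero_apply]
  | gen x => exact hw x m
  | add a b ha hb =>
    rw [map_add, LinearMap.add_apply, ha, hb, add_smul, add_smul, map_add]
    abel
  | mul a b ha hb =>
    rw [κ.map_mul, ha, hb, mul_smul, mul_smul, smul_sub]
    abel

theorem toFun_one (κ : Cocycle M N) : κ.toFun 1 = 0 := by
  rw [← (algebraMap K (D.Uχ p)).map_one, κ.map_algebraMap]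

theorem toFun_smul (κ : Cocycle M N) (k : K) (u : D.Uχ p) :
    κ.toFun (k • u) = algebraMap K A k • κ.toFun u := LinearMap.ext fun m => by
  rw [Algebra.smul_def, κ.map_mul, κ.map_algebraMap, LinearMap.zero_apply, zero_add,
    N.algebraMap_smul, LinearMap.smul_apply]

/-- The representation `u ↦ ((z, m) ↦ (u • z + κ u m, u • m))` of `U_χ` on `N × M`. -/
noncomputable def extensionHom (κ : Cocycle M N) :
    D.Uχ p →+* Module.End A (N.carrier × M.carrier) where
  toFun u := .prod (.coprod (Module.toModuleEnd A N.carrier u) (κ.toFun u))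
    (Module.toModuleEnd A M.carrier u ∘ₗ LinearMap.snd A N.carrier M.carrier)
  map_one' := LinearMap.ext fun z => Prod.ext (by simp [κ.toFun_one]) (by simp)
  map_mul' u v := LinearMap.ext fun z =>
    Prod.ext (by simp [κ.map_mul, mul_smul, add_assoc, add_comm (κ.toFun u _)]) (by simp [mul_smul])
  map_zero' := LinearMap.ext fun z => Prod.ext (by simp) (by simp)
  map_add' u v := LinearMap.ext fun z =>
    Prod.ext (by simp [add_smul, add_add_add_comm]) (by simp [add_smul])

/-- The extension of `M` by `N` that `κ` defines. -/
noncomputable def extension (κ : Cocycle M N) : D.PreObj p A where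
  carrier := N.carrier × M.carrier
  moduleU := Module.compHom _ κ.extensionHom
  smulCommClass := @SMulCommClass.mk _ _ _ (_) (_) fun u a z => (κ.extensionHom u).map_smul a z
  algebraMap_smul k z := Prod.ext
    (by
      change algebraMap K (D.Uχ p) k • z.1 + κ.toFun (algebraMap K (D.Uχ p) k) z.2 = _
      rw [κ.map_algebraMap, LinearMap.zero_apply, add_zero, N.algebraMap_smul]
      rfl)
    (M.algebraMap_smul k z.2)
  piece c φ := (N.piece c φ).prod (M.piece c φ)

theorem extension_smul (κ : Cocycle M N) (u : D.Uχ p) (z : N.carrier) (m : M.carrier) :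
    u • (show κ.extension.carrier from (z, m)) = (u • z + κ.toFun u m, u • m) :=
  rfl

theorem degPiece_extension (κ : Cocycle M N) (j : D.Deg) :
    κ.extension.degPiece j = (N.degPiece j).prod (M.degPiece j) :=
  rfl

section

variable {π : D.U0 →ₐ[K] A}

theorem isWeightModule_extension (κ : Cocycle M N) (hM : M.IsWeightModule π)
    (hN : N.IsWeightModule π) : κ.extension.IsWeightModule π where
  iSup_eq_top := iSup_prod_eq_top hN.iSup_eq_top hM.iSup_eq_top
  weights j hj := by
    by_cases hNj : N.degPiece j = ⊥
    · refine hM.weights j fun hMj => hj ?_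
      rw [degPiece_extension, hNj, hMj, Submodule.prod_bot]
      rfl
    · exact hN.weights j hNj
  h_smul x j z hz := by
    refine (κ.extension_smul _ z.1 z.2).trans ?_
    rw [κ.map_h, LinearMap.zero_apply, add_zero, hN.h_smul x j _ hz.1, hM.h_smul x j _ hz.2]
    rfl
  e_smul α hα j z hz :=
    ⟨add_mem (hN.e_smul α hα j _ hz.1) (κ.map_e α hα j _ hz.2), hM.e_smul α hα j _ hz.2⟩

theorem isObj_extension [IsNoetherianRing A] (κ : Cocycle M N) (hM : M.IsObj π)
    (hN : N.IsObj π) : κ.extension.IsObj π := by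
  have := hM.finite_carrier
  have := hN.finite_carrier
  exact PreObj.isObj_iff.2 ⟨κ.isWeightModule_extension hM.isWeightModule hN.isWeightModule,
    iSupIndep_prod hN.indep hM.indep, inferInstanceAs (Module.Finite A (N.carrier × M.carrier))⟩

theorem nonsplitExt [IsNoetherianRing A] (κ : Cocycle M N) (hM : M.IsObj π) (hN : N.IsObj π)
    (hκ : ¬κ.IsCoboundary) : PreObj.NonsplitExt π M N := by
  let i : N.Mor κ.extension :=
    { toFun := LinearMap.inl A N.carrier M.carrier
      map_smulU := fun u z => Prod.ext
        ((add_zero _).symm.trans (congrArg _ (map_zero (κ.toFun u)).symm)) (smul_zero u).symm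
      map_piece := fun c φ z hz => ⟨hz, zero_mem _⟩ }
  let q : κ.extension.Mor M :=
    { toFun := LinearMap.snd A N.carrier M.carrier
      map_smulU := fun u z => rfl
      map_piece := fun c φ z hz => hz.2 }
  refine ⟨κ.extension, κ.isObj_extension hM hN, i, q, LinearMap.inl_injective,
    LinearMap.range_inl .., LinearMap.snd_surjective, fun ⟨s, hs⟩ => hκ ?_⟩
  have hs₂ (m : M.carrier) : (s.toFun m).2 = m := LinearMap.congr_fun hs m
  refine ⟨LinearMap.fst A N.carrier M.carrier ∘ₗ s.toFun, fun j m hm => (s.map_degPiece hm).1,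
    fun u m => eq_sub_of_add_eq' ?_⟩
  have hsu := congrArg Prod.fst (s.map_smulU u m)
  rw [show u • s.toFun m = _ from κ.extension_smul u (s.toFun m).1 (s.toFun m).2, hs₂] at hsu
  exact hsu.symm

end

/-- An `A`-linear graded splitting of `0 → N → E → M → 0`. -/
structure GradedSplitting {E : D.PreObj p A} (i : N.Mor E) (q : E.Mor M) where
  sec : M.carrier →ₗ[A] E.carrier
  retr : E.carrier →ₗ[A] N.carrier
  proj_sec : ∀ m, q.toFun (sec m) = m
  retr_incl : ∀ z, retr (i.toFun z) = z
  incl_retr_add_sec_proj : ∀ z, i.toFun (retr z) + sec (q.toFun z) = z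
  sec_mem : ∀ j, ∀ m ∈ M.degPiece j, sec m ∈ E.degPiece j
  retr_mem : ∀ j, ∀ z ∈ E.degPiece j, retr z ∈ N.degPiece j

theorem GradedSplitting.nonempty_of_projective [Module.Projective A M.carrier] {E : D.PreObj p A}
    {i : N.Mor E} {q : E.Mor M} (hi : Function.Injective i.toFun)
    (hiq : LinearMap.range i.toFun = LinearMap.ker q.toFun) (hq : Function.Surjective q.toFun)
    (hM : iSupIndep M.degPiece) (hM' : ⨆ j, M.degPiece j = ⊤) (hN : ⨆ j, N.degPiece j = ⊤)
    (hE : iSupIndep E.degPiece) (hE' : ⨆ j, E.degPiece j = ⊤) :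
    Nonempty (GradedSplitting i q) := by
  classical
  let := (DirectSum.isInternal_submodule_of_iSupIndep_of_iSup_eq_top hM hM').chooseDecomposition
  let := (DirectSum.isInternal_submodule_of_iSupIndep_of_iSup_eq_top hE hE').chooseDecomposition
  obtain ⟨s, hqs, hs⟩ := exists_graded_section E.degPiece M.degPiece hq
    fun _ _ hz => q.map_degPiece hz
  replace hqs : ∀ m, q.toFun (s m) = m := LinearMap.congr_fun hqs
  have hker (z : E.carrier) : z - s (q.toFun z) ∈ LinearMap.range i.toFun := by
    rw [hiq, LinearMap.mem_ker, map_sub, hqs, sub_self]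
  let r : E.carrier →ₗ[A] N.carrier := (LinearEquiv.ofInjective i.toFun hi).symm.toLinearMap ∘ₗ
    (LinearMap.id - s ∘ₗ q.toFun).codRestrict _ hker
  have hir (z : E.carrier) : i.toFun (r z) = z - s (q.toFun z) :=
    congrArg Subtype.val ((LinearEquiv.ofInjective i.toFun hi).apply_symm_apply ⟨_, hker z⟩)
  have hqi (z : N.carrier) : q.toFun (i.toFun z) = 0 :=
    LinearMap.mem_ker.1 (hiq ▸ LinearMap.mem_range_self i.toFun z)
  refine ⟨s, r, hqs, fun z => hi ?_, fun z => ?_, hs, fun j z hz => ?_⟩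
  · rw [hir, hqi, map_zero, sub_zero]
  · rw [hir, sub_add_cancel]
  · refine i.mem_degPiece_of_injective hi hN hE ?_
    exact hir z ▸ sub_mem hz (hs j _ (q.map_degPiece hz))

namespace GradedSplitting

variable {E : D.PreObj p A} {i : N.Mor E} {q : E.Mor M} {π : D.U0 →ₐ[K] A}

theorem retr_sec (S : GradedSplitting i q) (m : M.carrier) : S.retr (S.sec m) = 0 := by
  have := S.incl_retr_add_sec_proj (S.sec m)
  rw [S.proj_sec, add_eq_right] at this
  rw [← S.retr_incl (S.retr (S.sec m)), this, map_zero]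

theorem incl_retr_smul_sec (S : GradedSplitting i q) (u : D.Uχ p) (m : M.carrier) :
    i.toFun (S.retr (u • S.sec m)) + S.sec (u • m) = u • S.sec m := by
  simpa only [q.map_smulU, S.proj_sec] using S.incl_retr_add_sec_proj (u • S.sec m)

/-- The deviation of the section from `U_χ`-linearity. -/
noncomputable def cocycle (S : GradedSplitting i q) (hM : ⨆ j, M.degPiece j = ⊤)
    (hE : E.IsWeightModule π) : Cocycle M N where
  toFun :=
    { toFun := fun u => S.retr ∘ₗ Module.toModuleEnd A E.carrier u ∘ₗ S.sec
      map_zero' := by rw [map_zero, LinearMap.zero_comp, LinearMap.comp_zero]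
      map_add' := fun u v => by rw [map_add, LinearMap.add_comp, LinearMap.comp_add] }
  map_algebraMap k := LinearMap.ext fun m => by
    change S.retr (algebraMap K (D.Uχ p) k • S.sec m) = 0
    rw [E.algebraMap_smul, map_smul, S.retr_sec, smul_zero]
  map_mul u v m := by
    change S.retr ((u * v) • S.sec m) = S.retr (u • S.sec (v • m)) + u • S.retr (v • S.sec m)
    rw [mul_smul, ← S.incl_retr_smul_sec v, smul_add, ← i.map_smulU, map_add, S.retr_incl,
      S.incl_retr_smul_sec, add_comm]
  map_h x := LinearMap.ext fun m => by
    have hm : m ∈ ⨆ j, M.degPiece j := hM ▸ trivial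
    induction hm using Submodule.iSup_induction' with
    | mem j m hm =>
      change S.retr (D.gen p (x : D.g) • S.sec m) = 0
      rw [hE.h_smul x j _ (S.sec_mem j m hm), map_smul, S.retr_sec, smul_zero]
    | zero => exact map_zero _
    | add m m' _ _ ih ih' => rw [map_add, ih, ih', map_add]
  map_e α hα j m hm := S.retr_mem _ _ (hE.e_smul α hα j _ (S.sec_mem j m hm))

theorem exists_section_of_isCoboundary (S : GradedSplitting i q) (hM : ⨆ j, M.degPiece j = ⊤)
    (hE : E.IsWeightModule π) (h : (S.cocycle hM hE).IsCoboundary) :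
    ∃ s : M.Mor E, q.toFun ∘ₗ s.toFun = LinearMap.id := by
  obtain ⟨w, hw, hκ⟩ := h
  have hqi (z : N.carrier) : q.toFun (i.toFun z) = 0 := by
    have := S.incl_retr_add_sec_proj (i.toFun z)
    rw [S.retr_incl, add_eq_left] at this
    rw [← S.proj_sec (q.toFun (i.toFun z)), this, map_zero]
  refine ⟨⟨S.sec + i.toFun ∘ₗ w, fun u m => ?_, fun c φ m hm =>
    add_mem (S.sec_mem (c, φ) m hm) (i.map_piece c φ _ (hw (c, φ) m hm))⟩,
    LinearMap.ext fun m => ?_⟩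
  · change S.sec (u • m) + i.toFun (w (u • m)) = u • (S.sec m + i.toFun (w m))
    have hκu : S.retr (u • S.sec m) = w (u • m) - u • w m := hκ u m
    rw [smul_add, ← S.incl_retr_smul_sec u m, ← i.map_smulU, eq_add_of_sub_eq hκu.symm, map_add]
    abel
  · change q.toFun (S.sec m + i.toFun (w m)) = m
    rw [map_add, S.proj_sec, hqi, add_zero]

end GradedSplitting

theorem exists_not_isCoboundary_of_nonsplitExt [Module.Projective A M.carrier] {π : D.U0 →ₐ[K] A}
    (hM : iSupIndep M.degPiece) (hM' : ⨆ j, M.degPiece j = ⊤) (hN : ⨆ j, N.degPiece j = ⊤)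
    (h : PreObj.NonsplitExt π M N) : ∃ κ : Cocycle M N, ¬κ.IsCoboundary := by
  obtain ⟨E, hE, i, q, hi, hiq, hq, hsplit⟩ := h
  obtain ⟨S⟩ := GradedSplitting.nonempty_of_projective hi hiq hq hM hM' hN hE.indep hE.iSup_eq_top
  exact ⟨S.cocycle hM' hE.isWeightModule,
    fun hκ => hsplit (S.exists_section_of_isCoboundary hM' hE.isWeightModule hκ)⟩

end Cocycle

end Cocycles

section CocycleDescent

variable {K : Type u} [Field K] {n : ℕ} {D : LeviDatum K n} {p : ℕ}
  {A : Type v} [CommRing A] [Algebra K A] {M N : D.PreObj p K}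

namespace Cocycle

/-- The base change of a cocycle. -/
noncomputable def baseChange (κ : Cocycle M N) : Cocycle (M.baseChange A) (N.baseChange A) where
  toFun :=
    { toFun := fun u => (κ.toFun u).baseChange A
      map_zero' := (congrArg _ (map_zero κ.toFun)).trans (LinearMap.baseChange_zero ..)
      map_add' := fun u v => (congrArg _ (map_add κ.toFun u v)).trans
        (LinearMap.baseChange_add ..) }
  map_algebraMap k := (congrArg _ (κ.map_algebraMap k)).trans (LinearMap.baseChange_zero ..)
  map_mul u v z := by
    have huv : κ.toFun (u * v) = κ.toFun u ∘ₗ Module.toModuleEnd K M.carrier v +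
        Module.toModuleEnd K N.carrier u ∘ₗ κ.toFun v := LinearMap.ext (κ.map_mul u v)
    have := congrArg (LinearMap.baseChange A) huv
    rw [LinearMap.baseChange_add, LinearMap.baseChange_comp, LinearMap.baseChange_comp] at this
    exact LinearMap.congr_fun this z
  map_h x := (congrArg _ (κ.map_h x)).trans (LinearMap.baseChange_zero ..)
  map_e α hα j _ hz := baseChange_mem_baseChange (κ.map_e α hα j) hz

/-- The slice of a cocycle between base changes. -/
noncomputable def slice (κ : Cocycle (M.baseChange A) (N.baseChange A)) (σ : Module.Dual K A) :
    Cocycle M N where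
  toFun :=
    { toFun := fun u => sliceHom σ (κ.toFun u)
      map_zero' := LinearMap.ext fun m => by
        rw [map_zero]
        exact map_zero (LinAlg.slice σ)
      map_add' := fun u v => LinearMap.ext fun m => by
        rw [map_add]
        exact map_add (LinAlg.slice σ) _ _ }
  map_algebraMap k := LinearMap.ext fun m =>
    (congrArg (fun f => sliceHom σ f m) (κ.map_algebraMap k)).trans (map_zero (LinAlg.slice σ))
  map_mul u v m := (congrArg (LinAlg.slice σ) (κ.map_mul u v (1 ⊗ₜ[K] m))).trans <|
    (map_add (LinAlg.slice σ) _ _).trans (congrArg _ (PreObj.slice_smul σ u _))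
  map_h x := LinearMap.ext fun m =>
    (congrArg (fun f => sliceHom σ f m) (κ.map_h x)).trans (map_zero (LinAlg.slice σ))
  map_e α hα j m hm := slice_mem_of_mem_baseChange σ
    (κ.map_e α hα j _ (Submodule.tmul_mem_baseChange_of_mem 1 hm))

theorem IsCoboundary.slice {κ : Cocycle (M.baseChange A) (N.baseChange A)} (hκ : κ.IsCoboundary)
    (σ : Module.Dual K A) : (κ.slice σ).IsCoboundary := by
  obtain ⟨w, hw, hκw⟩ := hκ
  refine ⟨sliceHom σ w, fun j m hm => slice_mem_of_mem_baseChange σ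
    (hw j _ (Submodule.tmul_mem_baseChange_of_mem 1 hm)), fun u m => ?_⟩
  exact (congrArg (LinAlg.slice σ) (hκw u (1 ⊗ₜ[K] m))).trans <|
    (map_sub (LinAlg.slice σ) _ _).trans (congrArg _ (PreObj.slice_smul σ u _))

theorem isCoboundary_of_baseChange [Nontrivial A] {κ : Cocycle M N}
    (hκ : (κ.baseChange (A := A)).IsCoboundary) : κ.IsCoboundary := by
  obtain ⟨σ, hσ⟩ := exists_sliceHom_baseChange_eq (K := K) (A := A) (V := M.carrier)
    (W := N.carrier)
  obtain ⟨w, hw, hκw⟩ := hκ.slice σ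
  exact ⟨w, hw, fun u m => (LinearMap.congr_fun (hσ (κ.toFun u)) m).symm.trans (hκw u m)⟩

end Cocycle

instance : Module.Finite K D.g :=
  inferInstanceAs (Module.Finite K (lieAlg D.G).toSubmodule)

namespace Cocycle

theorem exists_finset_sum_basis_tmul_slice [Module.Finite K M.carrier] {ι : Type*}
    (b : Module.Basis ι K A) (κ : Cocycle (M.baseChange A) (N.baseChange A)) :
    ∃ s : Finset ι, ∀ x m, ∑ k ∈ s, b k ⊗ₜ[K] (κ.slice (b.coord k)).toFun (D.gen p x) m =
      κ.toFun (D.gen p x) (1 ⊗ₜ[K] m) := by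
  let F (x : D.g) : A ⊗[K] M.carrier →ₗ[A] A ⊗[K] N.carrier := κ.toFun (D.gen p x)
  have hF_add (x y : D.g) : F (x + y) = F x + F y := by simp only [F, map_add]; rfl
  have hF_smul (k : K) (x : D.g) : F (k • x) = k • F x := by
    refine .trans ?_ (_root_.algebraMap_smul A k (F x))
    simp only [F, map_smul, κ.toFun_smul]
    rfl
  let f : D.g ⊗[K] M.carrier →ₗ[K] A ⊗[K] N.carrier := TensorProduct.lift <| LinearMap.mk₂ K
    (fun x m => F x (1 ⊗ₜ[K] m)) (fun x y m => by rw [hF_add, LinearMap.add_apply])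
    (fun k x m => by rw [hF_smul, LinearMap.smul_apply])
    (fun x m m' => by rw [TensorProduct.tmul_add, map_add])
    (fun k x m => by rw [TensorProduct.tmul_smul, LinearMap.map_smul_of_tower])
  obtain ⟨s, hs⟩ := exists_finset_forall_sum_basis_tmul_slice b f
  exact ⟨s, fun x m => hs (x ⊗ₜ[K] m)⟩

theorem isCoboundary_of_forall_slice [Module.Finite K M.carrier]
    {κ : Cocycle (M.baseChange A) (N.baseChange A)}
    (hκ : ∀ σ : Module.Dual K A, (κ.slice σ).IsCoboundary) : κ.IsCoboundary := by
  let b := Module.Basis.ofVectorSpace K A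
  obtain ⟨s, hs⟩ := κ.exists_finset_sum_basis_tmul_slice b
  choose w hw hκw using fun k => hκ (b.coord k)
  let W : A ⊗[K] M.carrier →ₗ[A] A ⊗[K] N.carrier := ∑ k ∈ s, b k • (w k).baseChange A
  have hW (m : M.carrier) : W (1 ⊗ₜ[K] m) = ∑ k ∈ s, b k ⊗ₜ[K] w k m := by
    simp [W, TensorProduct.smul_tmul']
  refine ⟨W, fun j z hz => ?_, fun u z => κ.eq_sub_of_gen (fun x z => ?_) u z⟩
  · have hWz : W z = ∑ k ∈ s, b k • (w k).baseChange A z := LinearMap.sum_apply ..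
    exact hWz ▸ sum_mem fun k _ => Submodule.smul_mem _ _ (baseChange_mem_baseChange (hw k j) hz)
  · let X : A ⊗[K] M.carrier →ₗ[A] A ⊗[K] M.carrier :=
      (Module.toModuleEnd K M.carrier (D.gen p x)).baseChange A
    let Y : A ⊗[K] N.carrier →ₗ[A] A ⊗[K] N.carrier :=
      (Module.toModuleEnd K N.carrier (D.gen p x)).baseChange A
    let κx : A ⊗[K] M.carrier →ₗ[A] A ⊗[K] N.carrier := κ.toFun (D.gen p x)
    suffices κx = W ∘ₗ X - Y ∘ₗ W from LinearMap.congr_fun this z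
    refine TensorProduct.AlgebraTensorModule.curry_injective <| LinearMap.ext_ring <|
      LinearMap.ext fun m => ?_
    have hWm : W (1 ⊗ₜ[K] (D.gen p x • m)) - Y (W (1 ⊗ₜ[K] m)) =
        ∑ k ∈ s, b k ⊗ₜ[K] (w k (D.gen p x • m) - D.gen p x • w k m) := by
      simp [hW, Y, TensorProduct.tmul_sub]
    refine Eq.trans ?_ hWm.symm
    simp only [← hκw]
    exact (hs x m).symm

end Cocycle

theorem PreObj.nonsplitExt_baseChange_iff [IsNoetherianRing A] [Nontrivial A] {ρ : D.U0 →ₐ[K] K}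
    (hM : M.IsObj ρ) (hN : N.IsObj ρ) :
    NonsplitExt ((Algebra.ofId K A).comp ρ) (M.baseChange A) (N.baseChange A) ↔
      NonsplitExt ρ M N := by
  have hMA := (isObj_baseChange_iff (A := A) hM.isWeightModule).2 hM
  have hNA := (isObj_baseChange_iff (A := A) hN.isWeightModule).2 hN
  constructor <;> intro h
  · have := hM.finite_carrier
    have : Module.Projective A (M.baseChange A).carrier :=
      inferInstanceAs (Module.Projective A (A ⊗[K] M.carrier))
    obtain ⟨κ, hκ⟩ := Cocycle.exists_not_isCoboundary_of_nonsplitExt hMA.indep hMA.iSup_eq_top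
      hNA.iSup_eq_top h
    obtain ⟨σ, hσ⟩ := not_forall.1 (mt Cocycle.isCoboundary_of_forall_slice hκ)
    exact (κ.slice σ).nonsplitExt hM hN hσ
  · obtain ⟨κ, hκ⟩ := Cocycle.exists_not_isCoboundary_of_nonsplitExt hM.indep hM.iSup_eq_top
      hN.iSup_eq_top h
    exact κ.baseChange.nonsplitExt hMA hNA (mt Cocycle.isCoboundary_of_baseChange hκ)

end CocycleDescent

/-! ### Baby Verma modules -/

section BabyVerma

variable {K : Type u} [Field K] {n : ℕ} {D : LeviDatum K n} {p : ℕ}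
  {A : Type v} [CommRing A] [Algebra K A] {M : D.PreObj p A} {π : D.U0 →ₐ[K] A} {l : D.X}

variable (p π l) in
/-- The standard generator of the baby Verma module, as an element of its carrier. -/
noncomputable def hwVec : (babyVerma p π l).carrier := VermaModule.vec p π l

theorem span_smul_hwVec :
    Submodule.span A (Set.range fun u : D.Uχ p => u • hwVec p π l) = ⊤ := by
  refine eq_top_iff.2 fun m _ => ?_
  obtain ⟨z, rfl⟩ := Submodule.Quotient.mk_surjective (vermaIdeal (p := p) π l) m
  induction z with
  | zero => exact zero_mem _
  | add z w hz hw => exact add_mem (hz trivial) (hw trivial)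
  | tmul u a =>
    have hmk : (Submodule.Quotient.mk (u ⊗ₜ[K] a) : VermaModule p π l) =
        a • u • VermaModule.vec p π l := by
      rw [VermaModule.smulA_def, VermaModule.smulU_def, smul_smul,
        Algebra.TensorProduct.tmul_mul_tmul, one_mul, mul_one, VermaModule.vec]
      change _ = Submodule.Quotient.mk ((u ⊗ₜ[K] a) • (1 : D.Uχ p ⊗[K] A))
      rw [smul_eq_mul, mul_one]
    exact hmk ▸ Submodule.smul_mem _ a (Submodule.subset_span ⟨u, rfl⟩)

theorem smul_vec_eq_zero {z : D.Uχ p ⊗[K] A} (hz : z ∈ vermaIdeal (p := p) π l) :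
    z • VermaModule.vec p π l = 0 := by
  change Submodule.Quotient.mk (z • (1 : D.Uχ p ⊗[K] A)) = _
  rw [smul_eq_mul, mul_one]
  exact (Submodule.Quotient.mk_eq_zero _).2 hz

/-- `w` is a maximal vector of weight `l`: it is annihilated by the positive root vectors, and `𝔥`
acts on it by `π + dl`. -/
structure IsMaximalVector {W : Type*} [AddCommGroup W] [Module (D.Uχ p) W] [Module A W]
    (π : D.U0 →ₐ[K] A) (l : D.X) (w : W) : Prop where
  e_smul : ∀ α ∈ D.Rpos, D.gen p (D.e α) • w = 0
  h_smul : ∀ x : D.h, D.gen p (x : D.g) • w =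
    (π (UniversalEnvelopingAlgebra.ι K x) + algebraMap K A (D.d l x)) • w

theorem isMaximalVector_hwVec : IsMaximalVector (p := p) π l (hwVec p π l) where
  e_smul α hα := smul_vec_eq_zero (Submodule.subset_span (Or.inl ⟨α, hα, rfl⟩))
  h_smul x := by
    have := smul_vec_eq_zero (p := p) (π := π) (l := l)
      (Submodule.subset_span (Or.inr ⟨UniversalEnvelopingAlgebra.ι K x, rfl⟩))
    rwa [sub_smul, sub_eq_zero, ofU0_ι, shift_ι, map_add, AlgHom.commutes] at this

theorem IsMaximalVector.exists_linearMap {W : Type*} [AddCommGroup W] [Module K W]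
    [Module (D.Uχ p) W] [Module A W] [IsScalarTower K (D.Uχ p) W] [IsScalarTower K A W]
    [SMulCommClass (D.Uχ p) A W] {w : W} (hw : IsMaximalVector (p := p) π l w) :
    ∃ f : (babyVerma p π l).carrier →ₗ[A] W,
      f (hwVec p π l) = w ∧ ∀ (u : D.Uχ p) m, f (u • m) = u • f m := by
  let _ : Module (D.Uχ p ⊗[K] A) W := TensorProduct.Algebra.module
  have hsmul (u : D.Uχ p) (a : A) (w : W) : (u ⊗ₜ[K] a) • w = u • a • w :=
    TensorProduct.Algebra.smul_def u a w
  have hker : vermaIdeal (p := p) π l ≤ LinearMap.ker (LinearMap.toSpanSingleton _ W w) := by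
    refine Submodule.span_le.2 ?_
    rintro _ (⟨α, hα, rfl⟩ | ⟨s, rfl⟩) <;>
      rw [SetLike.mem_coe, LinearMap.mem_ker, LinearMap.toSpanSingleton_apply]
    · rw [hsmul, one_smul, hw.e_smul α hα]
    · rw [sub_smul, hsmul, hsmul, one_smul, one_smul, sub_eq_zero]
      exact ofU0_smul_of_h_smul
        (fun k w => by rw [algebraMap_smul, algebraMap_smul]) hw.h_smul s
  let f : VermaModule p π l →ₗ[D.Uχ p ⊗[K] A] W := Submodule.liftQ _ _ hker
  refine ⟨{ toFun := f, map_add' := f.map_add, map_smul' := fun a m => ?_ }, ?_, fun u m => ?_⟩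
  · exact (f.map_smul _ m).trans ((hsmul 1 a _).trans (one_smul _ _))
  · exact one_smul (D.Uχ p ⊗[K] A) w
  · exact (f.map_smul _ m).trans ((hsmul u 1 _).trans (congrArg _ (one_smul A _)))

theorem babyVerma_hom_ext {W : Type*} [AddCommGroup W] [Module (D.Uχ p) W] [Module A W]
    {f g : (babyVerma p π l).carrier →ₗ[A] W} (hf : ∀ (u : D.Uχ p) m, f (u • m) = u • f m)
    (hg : ∀ (u : D.Uχ p) m, g (u • m) = u • g m) (h : f (hwVec p π l) = g (hwVec p π l)) :
    f = g := by
  refine LinearMap.ext_on span_smul_hwVec ?_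
  rintro _ ⟨u, rfl⟩
  rw [hf, hg, h]

theorem babyVerma_degPiece (j : D.Deg) :
    (babyVerma p π l).degPiece j = Submodule.span A
      {m | ∃ u μ, D.Word p u μ ∧ D.deg μ + D.deg l = j ∧ m = u • hwVec p π l} := by
  have hpiece : (babyVerma p π l).degPiece j =
      Submodule.span A {m | ∃ u ∈ D.wordSpan p (j - D.deg l), m = u • hwVec p π l} := by
    rw [← gradeWeight_eq_wordSpan]
    rfl
  rw [hpiece]
  refine le_antisymm (Submodule.span_le.2 ?_) (Submodule.span_mono ?_)
  · rintro _ ⟨u, hu, rfl⟩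
    induction hu using Submodule.span_induction with
    | mem u hu =>
      obtain ⟨μ, hμ, hj⟩ := hu
      exact Submodule.subset_span ⟨u, μ, hμ, eq_sub_iff_add_eq.1 hj, rfl⟩
    | zero => exact zero_smul (D.Uχ p) (hwVec p π l) ▸ zero_mem _
    | add u u' _ _ h h' => exact add_smul u u' (hwVec p π l) ▸ add_mem h h'
    | smul r u _ h =>
      rw [Algebra.smul_def, mul_smul, PreObj.algebraMap_smul]
      exact Submodule.smul_mem _ _ h
  · rintro _ ⟨u, μ, hu, rfl, rfl⟩
    refine ⟨u, ?_, rfl⟩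
    rw [add_sub_cancel_right]
    exact hu.mem_wordSpan

theorem Word.smul_hwVec_mem {u : D.Uχ p} {μ : D.X} (hu : D.Word p u μ) :
    u • hwVec p π l ∈ (babyVerma p π l).degPiece (D.deg μ + D.deg l) :=
  babyVerma_degPiece (p := p) (π := π) (l := l) _ ▸
    Submodule.subset_span ⟨u, μ, hu, rfl, rfl⟩

theorem hwVec_mem_degPiece : hwVec p π l ∈ (babyVerma p π l).degPiece (D.deg l) := by
  simpa only [one_smul, map_zero, zero_add] using Word.one.smul_hwVec_mem (p := p) (π := π) (l := l)

theorem babyVerma_degPiece_le {N : Submodule A (babyVerma p π l).carrier} {j : D.Deg}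
    (hN : ∀ u μ, D.Word p u μ → D.deg μ + D.deg l = j → u • hwVec p π l ∈ N) :
    (babyVerma p π l).degPiece j ≤ N := by
  rw [babyVerma_degPiece, Submodule.span_le]
  rintro _ ⟨u, μ, hu, hj, rfl⟩
  exact hN u μ hu hj

theorem h_smul_of_mem_babyVerma_degPiece (x : D.h) {j : D.Deg} {m : (babyVerma p π l).carrier}
    (hm : m ∈ (babyVerma p π l).degPiece j) :
    D.gen p (x : D.g) • m =
      (π (UniversalEnvelopingAlgebra.ι K x) + algebraMap K A (j.2 x)) • m := by
  rw [babyVerma_degPiece] at hm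
  refine LinearMap.eqOn_span (f := Module.toModuleEnd A (babyVerma p π l).carrier (D.gen p x.1))
    (g := LinearMap.lsmul A _ (π (UniversalEnvelopingAlgebra.ι K x) + algebraMap K A (j.2 x)))
    ?_ hm
  rintro _ ⟨u, μ, hu, rfl, rfl⟩
  have hcomm : D.gen p (x : D.g) * u = u * D.gen p (x : D.g) + D.d μ x • u := by
    rw [← hu.lie_gen_h x, Ring.lie_def, add_sub_cancel]
  have hweight : D.gen p (x : D.g) • u • hwVec p π l = (π (UniversalEnvelopingAlgebra.ι K x) +
      (algebraMap K A (D.d μ x) + algebraMap K A (D.d l x))) • u • hwVec p π l := by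
    rw [smul_smul, hcomm, add_smul, mul_smul, isMaximalVector_hwVec.h_smul, smul_comm u,
      Algebra.smul_def, mul_smul, PreObj.algebraMap_smul, ← add_smul]
    ring_nf
  rw [← map_add] at hweight
  exact hweight

theorem e_smul_mem_babyVerma_degPiece {α : D.X} (hα : α ∈ D.R) {j : D.Deg}
    {m : (babyVerma p π l).carrier} (hm : m ∈ (babyVerma p π l).degPiece j) :
    D.gen p (D.e α) • m ∈ (babyVerma p π l).degPiece (D.deg α + j) := by
  refine babyVerma_degPiece_le (N := ((babyVerma p π l).degPiece _).comap
    (Module.toModuleEnd A _ (D.gen p (D.e α)))) (fun u μ hu hj => ?_) hm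
  have := (Word.e_mul α hα hu).smul_hwVec_mem (π := π) (l := l)
  rwa [mul_smul, map_add, add_assoc, hj] at this

theorem iSup_babyVerma_degPiece : ⨆ j, (babyVerma p π l).degPiece j = ⊤ := by
  refine eq_top_iff.2 (span_smul_hwVec.ge.trans (Submodule.span_le.2 ?_))
  rintro _ ⟨u, rfl⟩
  refine PreObj.smul_mem_of_gen_smul_mem (fun x m hm => ?_) u
    (Submodule.mem_iSup_of_mem _ hwVec_mem_degPiece)
  induction hm using Submodule.iSup_induction' with
  | zero => exact (smul_zero (A := (babyVerma p π l).carrier) (D.gen p x)).symm ▸ zero_mem _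
  | add m m' _ _ h h' => exact smul_add (D.gen p x) m m' ▸ add_mem h h'
  | mem j m hm =>
    induction x using g_induction with
    | h x =>
      rw [h_smul_of_mem_babyVerma_degPiece x hm]
      exact Submodule.mem_iSup_of_mem j (Submodule.smul_mem _ _ hm)
    | e α hα => exact Submodule.mem_iSup_of_mem _ (e_smul_mem_babyVerma_degPiece hα hm)
    | add x y hx hy =>
      rw [map_add, add_smul]
      exact add_mem hx hy
    | smul r x hx =>
      rw [map_smul, Algebra.smul_def, mul_smul, PreObj.algebraMap_smul]
      exact Submodule.smul_mem _ _ hx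

theorem isWeightModule_babyVerma : (babyVerma p π l).IsWeightModule π where
  iSup_eq_top := iSup_babyVerma_degPiece
  weights j hj := by
    contrapose! hj
    refine eq_bot_iff.2 (babyVerma_degPiece_le fun u μ _ hμ => absurd ?_ (hj (μ + l) 0 ?_))
    · exact (map_add D.d μ l).trans (congrArg Prod.snd hμ)
    · rw [smul_zero, add_zero, ← hμ]
      rfl
  h_smul x j m hm := h_smul_of_mem_babyVerma_degPiece x hm
  e_smul α hα j m hm := e_smul_mem_babyVerma_degPiece hα hm

variable (M) in
/-- The action of `K` on `M` through `A`. -/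
abbrev PreObj.moduleK : Module K M.carrier := Module.compHom M.carrier (algebraMap K A)

theorem PreObj.exists_mor_babyVerma (hM : M.IsWeightModule π) {v : M.carrier}
    (hv : v ∈ M.degPiece (D.deg l)) (hev : ∀ α ∈ D.Rpos, D.gen p (D.e α) • v = 0) :
    ∃ f : (babyVerma p π l).Mor M, f.toFun (hwVec p π l) = v := by
  let _ := M.moduleK
  have : IsScalarTower K A M.carrier := .of_algebraMap_smul fun _ _ => rfl
  have : IsScalarTower K (D.Uχ p) M.carrier := .of_algebraMap_smul M.algebraMap_smul
  obtain ⟨f, hfv, hf⟩ := IsMaximalVector.exists_linearMap (π := π) (l := l)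
    ⟨hev, fun x => hM.h_smul x _ v hv⟩
  have hpiece (j : D.Deg) : (babyVerma p π l).degPiece j ≤ (M.degPiece j).comap f :=
    babyVerma_degPiece_le fun u μ hu hj => by
      rw [Submodule.mem_comap, hf, hfv, ← hj]
      exact hM.word_smul hu hv
  exact ⟨⟨f, hf, fun c φ => @hpiece (c, φ)⟩, hfv⟩

/-- A twist isomorphism given by a pair of mutually inverse maps. -/
def PreObj.TwistIso.ofInverse {ε : D.g →ₗ[K] A} {M M' : D.PreObj p A}
    (f : M.carrier →ₗ[A] M'.carrier) (g : M'.carrier →ₗ[A] M.carrier)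
    (hfg : f ∘ₗ g = LinearMap.id) (hgf : g ∘ₗ f = LinearMap.id)
    (hgen : ∀ x m, D.gen p x • f m = f (D.gen p x • m) + ε x • f m)
    (hf : ∀ j, ∀ m ∈ M.degPiece j, f m ∈ M'.degPiece j)
    (hg : ∀ j, ∀ m ∈ M'.degPiece j, g m ∈ M.degPiece j) : PreObj.TwistIso ε M M' where
  toEquiv := LinearEquiv.ofLinearMap f g hfg hgf
  map_gen_smul := hgen
  map_degPiece j := le_antisymm (Submodule.map_le_iff_le_comap.2 (hf j))
    fun m hm => ⟨g m, hg j m hm, LinearMap.congr_fun hfg m⟩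

theorem IsTwist.exists_linearMap_babyVerma {ε : D.g →ₗ[K] A} {π' : D.U0 →ₐ[K] A}
    (hε : D.IsTwist ε π π') :
    ∃ f : (babyVerma p π' l).carrier →ₗ[A] (babyVerma p π l).carrier,
      f (hwVec p π' l) = hwVec p π l ∧
      (∀ x m, f (D.gen p x • m) = D.gen p x • f m + ε x • f m) ∧
      ∀ j, ∀ m ∈ (babyVerma p π' l).degPiece j, f m ∈ (babyVerma p π l).degPiece j := by
  let t := (babyVerma p π l).toTwist hε.toIsTwistForm
  obtain ⟨f, hf⟩ := PreObj.exists_mor_babyVerma (l := l)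
    (t.isWeightModule hε isWeightModule_babyVerma) (t.mem_degPiece hwVec_mem_degPiece)
    fun α hα => by
      rw [t.map_gen_smul, isMaximalVector_hwVec.e_smul α hα, hε.map_e α (D.Rpos_subset_R hα),
        zero_smul, map_zero, add_zero]
  exact ⟨f.toFun, hf, fun x m => (f.map_smulU _ m).trans (t.map_gen_smul x _),
    fun j m hm => f.map_degPiece hm⟩

theorem IsTwist.nonempty_twistIso_babyVerma {ε : D.g →ₗ[K] A} {π' : D.U0 →ₐ[K] A}
    (hε : D.IsTwist ε π π') (l : D.X) :
    Nonempty (PreObj.TwistIso ε (babyVerma p π l) (babyVerma p π' l)) := by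
  obtain ⟨f, hf, hf_gen, hf_mem⟩ := hε.exists_linearMap_babyVerma (p := p) (l := l)
  obtain ⟨g, hg, hg_gen, hg_mem⟩ := hε.neg.exists_linearMap_babyVerma (p := p) (l := l)
  have hgen (x m) : D.gen p x • g m = g (D.gen p x • m) + ε x • g m := by
    rw [hg_gen, LinearMap.neg_apply, neg_smul, neg_add_cancel_right]
  refine ⟨.ofInverse g f ?_ ?_ hgen hg_mem hf_mem⟩ <;>
    refine babyVerma_hom_ext (PreObj.map_smul_of_map_gen_smul fun x m => ?_) (fun _ _ => rfl) ?_
  · rw [LinearMap.comp_apply, hf_gen, map_add, g.map_smul (ε x), ← hgen, LinearMap.comp_apply]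
  · rw [LinearMap.comp_apply, hf, hg, LinearMap.id_apply]
  · rw [LinearMap.comp_apply, LinearMap.comp_apply, hg_gen, map_add, f.map_smul ((-ε) x), hf_gen,
      LinearMap.neg_apply, neg_smul, add_neg_cancel_right]
  · rw [LinearMap.comp_apply, hg, hf, LinearMap.id_apply]

theorem exists_linearMap_of_babyVerma {ρ : D.U0 →ₐ[K] K} (hπ : (Algebra.ofId K A).comp ρ = π) :
    ∃ g : A ⊗[K] (babyVerma p ρ l).carrier →ₗ[A] (babyVerma p π l).carrier,
      g (1 ⊗ₜ hwVec p ρ l) = hwVec p π l ∧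
      (∀ (u : D.Uχ p) m, g (1 ⊗ₜ (u • m)) = u • g (1 ⊗ₜ m)) ∧
      ∀ j, ∀ m ∈ (babyVerma p ρ l).degPiece j, g (1 ⊗ₜ m) ∈ (babyVerma p π l).degPiece j := by
  let N := babyVerma p π l
  let _ := N.moduleK
  have : IsScalarTower K A N.carrier := .of_algebraMap_smul fun _ _ => rfl
  have : IsScalarTower K (D.Uχ p) N.carrier := .of_algebraMap_smul N.algebraMap_smul
  have : SMulCommClass (D.Uχ p) K N.carrier := ⟨fun u k m => smul_comm u (algebraMap K A k) m⟩
  have hweight (x : D.h) : π (UniversalEnvelopingAlgebra.ι K x) + algebraMap K A (D.d l x) =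
      algebraMap K A (ρ (UniversalEnvelopingAlgebra.ι K x) + D.d l x) := by
    rw [← hπ, AlgHom.comp_apply, Algebra.ofId_apply, ← map_add]
  have hmax : IsMaximalVector (p := p) ρ l (hwVec p π l) :=
    ⟨isMaximalVector_hwVec.e_smul, fun x => (isMaximalVector_hwVec.h_smul x).trans
      (congrArg (· • hwVec p π l) (hweight x))⟩
  obtain ⟨g, hg, hg_smul⟩ := hmax.exists_linearMap
  have hg_mem (j : D.Deg) : (babyVerma p ρ l).degPiece j ≤
      ((N.degPiece j).restrictScalars K).comap g :=
    babyVerma_degPiece_le fun u μ hu hj => by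
      rw [Submodule.mem_comap, hg_smul, hg, ← hj]
      exact hu.smul_hwVec_mem
  refine ⟨g.liftBaseChange A, ?_, fun u m => ?_, fun j m hm => ?_⟩ <;>
    simp only [LinearMap.liftBaseChange_tmul, one_smul]
  exacts [hg, hg_smul u m, hg_mem j hm]

theorem exists_mor_baseChange_babyVerma {ρ : D.U0 →ₐ[K] K}
    (hπ : (Algebra.ofId K A).comp ρ = π) :
    ∃ g : ((babyVerma p ρ l).baseChange A).Mor (babyVerma p π l),
      g.toFun (1 ⊗ₜ[K] hwVec p ρ l) = hwVec p π l := by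
  obtain ⟨g, hg, hg_smul, hg_mem⟩ := exists_linearMap_of_babyVerma (p := p) (l := l) hπ
  refine ⟨⟨g, fun u z => ?_, fun c φ => ?_⟩, hg⟩
  · let _ := (babyVerma p π l).moduleK
    have : IsScalarTower K A (babyVerma p π l).carrier := .of_algebraMap_smul fun _ _ => rfl
    refine LinearMap.congr_fun (f := g ∘ₗ (Module.toModuleEnd K _ u).baseChange A)
      (g := Module.toModuleEnd A (babyVerma p π l).carrier u ∘ₗ g) ?_ z
    exact TensorProduct.AlgebraTensorModule.curry_injective <| LinearMap.ext_ring <|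
      LinearMap.ext <| hg_smul u
  · change ((babyVerma p ρ l).degPiece (c, φ)).baseChange A ≤
      ((babyVerma p π l).degPiece (c, φ)).comap g
    rw [Submodule.baseChange_eq_span, Submodule.span_le]
    rintro _ ⟨m, hm, rfl⟩
    exact hg_mem _ m hm

theorem baseChange_babyVerma_hom_ext {ρ : D.U0 →ₐ[K] K}
    {f g : ((babyVerma p ρ l).baseChange A).carrier →ₗ[A] M.carrier}
    (hf : ∀ (u : D.Uχ p) m, f (u • m) = u • f m) (hg : ∀ (u : D.Uχ p) m, g (u • m) = u • g m)
    (h : f (1 ⊗ₜ[K] hwVec p ρ l) = g (1 ⊗ₜ[K] hwVec p ρ l)) : f = g := by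
  let _ := M.moduleK
  have : IsScalarTower K A M.carrier := .of_algebraMap_smul fun _ _ => rfl
  exact TensorProduct.AlgebraTensorModule.curry_injective <| LinearMap.ext_ring <|
    babyVerma_hom_ext (p := p) (fun u m => hf u (1 ⊗ₜ m)) (fun u m => hg u (1 ⊗ₜ m)) h

theorem nonempty_twistIso_baseChange_babyVerma {ρ : D.U0 →ₐ[K] K}
    (hπ : (Algebra.ofId K A).comp ρ = π) (l : D.X) :
    Nonempty (PreObj.TwistIso 0 ((babyVerma p ρ l).baseChange A) (babyVerma p π l)) := by
  let B := (babyVerma p ρ l).baseChange A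
  obtain ⟨g, hg⟩ := exists_mor_baseChange_babyVerma (p := p) (l := l) hπ
  obtain ⟨f, hf⟩ : ∃ f : (babyVerma p π l).Mor B, f.toFun (hwVec p π l) = 1 ⊗ₜ hwVec p ρ l :=
    PreObj.exists_mor_babyVerma (hπ ▸ isWeightModule_babyVerma.baseChange)
      (Submodule.tmul_mem_baseChange_of_mem 1 hwVec_mem_degPiece) fun α hα =>
        (congrArg _ (isMaximalVector_hwVec.e_smul α hα)).trans (TensorProduct.tmul_zero _ _)
  have hgen (x : D.g) (z : B.carrier) : D.gen p x • g.toFun z =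
      g.toFun (D.gen p x • z) + (0 : D.g →ₗ[K] A) x • g.toFun z := by
    rw [g.map_smulU, LinearMap.zero_apply, zero_smul, add_zero]
  refine ⟨.ofInverse g.toFun f.toFun ?_ ?_ hgen (fun _ _ => g.map_degPiece)
    fun _ _ => f.map_degPiece⟩
  · refine babyVerma_hom_ext (fun u m => ?_) (fun _ _ => rfl) ?_
    · rw [LinearMap.comp_apply, f.map_smulU, g.map_smulU, LinearMap.comp_apply]
    · rw [LinearMap.comp_apply, hf, hg, LinearMap.id_apply]
  · refine baseChange_babyVerma_hom_ext (fun u m => ?_) (fun _ _ => rfl) ?_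
    · rw [LinearMap.comp_apply, g.map_smulU, f.map_smulU, LinearMap.comp_apply]
    · exact (congrArg f.toFun hg).trans hf

/-- `M` with its pieces replaced by the submodules `P j`. -/
def PreObj.regrade (M : D.PreObj p A) (P : D.Deg → Submodule A M.carrier) : D.PreObj p A :=
  { M with piece := fun c φ => P (c, φ) }

/-- The submodules `P j` of the pieces of `M` form a decomposition of `M` compatible with the root
vectors. The pieces of `M` itself are not assumed to be independent. -/
structure PreObj.IsSubgrading (M : D.PreObj p A) (P : D.Deg → Submodule A M.carrier) : Prop where
  le_degPiece : ∀ j, P j ≤ M.degPiece j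
  indep : iSupIndep P
  iSup_eq_top : ⨆ j, P j = ⊤
  e_smul : ∀ α ∈ D.R, ∀ j, ∀ m ∈ P j, D.gen p (D.e α) • m ∈ P (D.deg α + j)

theorem PreObj.IsSubgrading.isWeightModule {P : D.Deg → Submodule A M.carrier}
    (hP : M.IsSubgrading P) (hM : M.IsWeightModule π) : (M.regrade P).IsWeightModule π where
  iSup_eq_top := hP.iSup_eq_top
  weights j hj := hM.weights j fun h => hj (eq_bot_iff.2 (h ▸ hP.le_degPiece j))
  h_smul x j m hm := hM.h_smul x j m (hP.le_degPiece j hm)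
  e_smul := hP.e_smul

/- The degree `λ` component of the generator is again maximal, so it is the image of the generator
under an endomorphism `f`. On degree `j`, this `f` is the projection to `P j`; hence `f = id`. -/
theorem hwVec_mem_of_isSubgrading {P : D.Deg → Submodule A (babyVerma p π l).carrier}
    (hP : (babyVerma p π l).IsSubgrading P) : hwVec p π l ∈ P (D.deg l) := by
  classical
  let Z := (babyVerma p π l).regrade P
  have hZ : Z.IsWeightModule π := hP.isWeightModule isWeightModule_babyVerma
  let _ : DirectSum.Decomposition P :=
    (DirectSum.isInternal_submodule_of_iSupIndep_of_iSup_eq_top hP.indep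
      hP.iSup_eq_top).chooseDecomposition
  let proj (j : D.Deg) : (babyVerma p π l).carrier →ₗ[A] Z.carrier :=
    (P j).subtype ∘ₗ DirectSum.component A D.Deg (fun j => P j) j ∘ₗ
      (DirectSum.decomposeLinearEquiv P).toLinearMap
  have hproj_smul {u : D.Uχ p} {μ : D.X} (hu : D.Word p u μ) (m) (j : D.Deg) :
      proj (D.deg μ + j) (u • m) = u • proj j m :=
    coe_decompose_map P P (add_right_injective (D.deg μ))
      (f := Module.toModuleEnd A (babyVerma p π l).carrier u)
      (fun j m hm => hZ.word_smul (m := m) hu hm) m j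
  obtain ⟨f, hf⟩ : ∃ f : (babyVerma p π l).Mor Z,
      f.toFun (hwVec p π l) = proj (D.deg l) (hwVec p π l) := by
    refine PreObj.exists_mor_babyVerma hZ (SetLike.coe_mem _) fun α hα => ?_
    have := hproj_smul (Word.e_mul α (D.Rpos_subset_R hα) .one) (hwVec p π l) (D.deg l)
    rw [mul_one, isMaximalVector_hwVec.e_smul α hα, map_zero] at this
    exact this.symm
  have hf_proj (j : D.Deg) : (babyVerma p π l).degPiece j ≤ LinearMap.eqLocus f.toFun (proj j) :=
    babyVerma_degPiece_le fun u μ hu hj => by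
      rw [LinearMap.mem_eqLocus, f.map_smulU, hf, ← hj, hproj_smul hu]
  have hf_id : ⨆ j, P j ≤ LinearMap.eqLocus f.toFun LinearMap.id := iSup_le fun j m hm =>
    (hf_proj j (hP.le_degPiece j hm)).trans (DirectSum.decompose_of_mem_same P hm)
  have hv : proj (D.deg l) (hwVec p π l) = hwVec p π l :=
    hf.symm.trans (hf_id (hP.iSup_eq_top ▸ Submodule.mem_top))
  exact hv ▸ SetLike.coe_mem _

theorem babyVerma_degPiece_eq_of_isSubgrading
    {P : D.Deg → Submodule A (babyVerma p π l).carrier}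
    (hP : (babyVerma p π l).IsSubgrading P) : (babyVerma p π l).degPiece = P :=
  funext fun j => le_antisymm (babyVerma_degPiece_le fun _ _ hu hj => hj ▸
    (hP.isWeightModule isWeightModule_babyVerma).word_smul hu (hwVec_mem_of_isSubgrading hP))
    (hP.le_degPiece j)

theorem PreObj.Mor.isObj_of_injective [IsNoetherianRing A] {E : D.PreObj p A} (i : M.Mor E)
    (hi : Function.Injective i.toFun) (hM : M.IsWeightModule π) (hE : E.IsObj π) : M.IsObj π := by
  obtain ⟨-, hind, hfin⟩ := PreObj.isObj_iff.1 hE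
  exact PreObj.isObj_iff.2 ⟨hM, (iSupIndep_comap hind hi).mono fun _ _ => i.map_degPiece,
    .of_injective i.toFun hi⟩

theorem isSubgrading_map {E N M : D.PreObj p A} (hE : E.IsWeightModule π)
    (hind : iSupIndep E.degPiece) (hN : ⨆ j, N.degPiece j = ⊤) (i : N.Mor E) (q : E.Mor M)
    (hiq : LinearMap.range i.toFun = LinearMap.ker q.toFun) (hq : Function.Surjective q.toFun) :
    M.IsSubgrading fun j => (E.degPiece j).map q.toFun where
  le_degPiece _ := Submodule.map_le_iff_le_comap.2 fun _ => q.map_degPiece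
  indep := by
    refine iSupIndep_map_of_ker_le hind q.toFun ?_
    rw [← hiq, ← Submodule.map_top, ← hN, Submodule.map_iSup]
    refine iSup_mono fun j => le_inf ?_ (Submodule.map_le_iff_le_comap.2 fun _ => i.map_degPiece)
    rw [← Submodule.map_iSup, hN]
    exact Submodule.map_mono le_top
  iSup_eq_top := by
    rw [← Submodule.map_iSup, hE.iSup_eq_top, Submodule.map_top, LinearMap.range_eq_top.2 hq]
  e_smul α hα j := by
    rintro _ ⟨m, hm, rfl⟩
    exact ⟨_, hE.e_smul α hα j m hm, q.map_smulU _ m⟩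

theorem isObj_babyVerma_of_surjective [IsNoetherianRing A] {E N : D.PreObj p A} (hE : E.IsObj π)
    (hN : ⨆ j, N.degPiece j = ⊤) (i : N.Mor E) (q : E.Mor (babyVerma p π l))
    (hiq : LinearMap.range i.toFun = LinearMap.ker q.toFun) (hq : Function.Surjective q.toFun) :
    (babyVerma p π l).IsObj π := by
  obtain ⟨hE', hind, hfin⟩ := PreObj.isObj_iff.1 hE
  have hP := isSubgrading_map hE' hind hN i q hiq hq
  exact PreObj.isObj_iff.2 ⟨isWeightModule_babyVerma,
    babyVerma_degPiece_eq_of_isSubgrading hP ▸ hP.indep, .of_surjective q.toFun hq⟩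

theorem ExtNonzero.isObj [IsNoetherianRing A] {l m : D.X} (h : ExtNonzero p π l m) :
    (babyVerma p π l).IsObj π ∧ (babyVerma p π m).IsObj π := by
  obtain ⟨E, hE, i, q, hi, hiq, hq, -⟩ := h
  exact ⟨isObj_babyVerma_of_surjective hE iSup_babyVerma_degPiece i q hiq hq,
    i.isObj_of_injective hi isWeightModule_babyVerma hE⟩

end BabyVerma

/-! ### Blocks -/

section Blocks

variable {K : Type u} [Field K] {n : ℕ} {D : LeviDatum K n} {p : ℕ}
  {A : Type v} [CommRing A] [Algebra K A] {π π' : D.U0 →ₐ[K] A} {l m : D.X}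

theorem isTwist_zero : D.IsTwist 0 π π where
  map_lie _ _ := rfl
  map_e _ _ := rfl
  map_h _ := (add_zero _).symm

theorem IsTwist.homNonzero_iff {ε : D.g →ₗ[K] A} (hε : D.IsTwist ε π π') :
    HomNonzero p π l m ↔ HomNonzero p π' l m := by
  obtain ⟨f⟩ := hε.nonempty_twistIso_babyVerma (p := p) l
  obtain ⟨g⟩ := hε.nonempty_twistIso_babyVerma (p := p) m
  exact f.nonzeroHom_iff g

theorem IsTwist.extNonzero_iff [IsNoetherianRing A] {ε : D.g →ₗ[K] A} (hε : D.IsTwist ε π π') :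
    ExtNonzero p π l m ↔ ExtNonzero p π' l m := by
  obtain ⟨f⟩ := hε.nonempty_twistIso_babyVerma (p := p) l
  obtain ⟨g⟩ := hε.nonempty_twistIso_babyVerma (p := p) m
  exact f.nonsplitExt_iff g hε

theorem homNonzero_baseChange_iff [Nontrivial A] {ρ : D.U0 →ₐ[K] K} :
    HomNonzero p ((Algebra.ofId K A).comp ρ) l m ↔ HomNonzero p ρ l m := by
  obtain ⟨f⟩ := nonempty_twistIso_baseChange_babyVerma (A := A) (p := p) (ρ := ρ) rfl l
  obtain ⟨g⟩ := nonempty_twistIso_baseChange_babyVerma (A := A) (p := p) (ρ := ρ) rfl m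
  exact (f.nonzeroHom_iff g).symm.trans PreObj.nonzeroHom_baseChange_iff

theorem isObj_babyVerma_baseChange_iff [IsNoetherianRing A] [Nontrivial A] {ρ : D.U0 →ₐ[K] K} :
    (babyVerma p ((Algebra.ofId K A).comp ρ) l).IsObj ((Algebra.ofId K A).comp ρ) ↔
      (babyVerma p ρ l).IsObj ρ := by
  obtain ⟨f⟩ := nonempty_twistIso_baseChange_babyVerma (A := A) (p := p) (ρ := ρ) rfl l
  rw [← PreObj.isObj_baseChange_iff (A := A) isWeightModule_babyVerma]
  exact ⟨f.symm.isObj isTwist_zero.neg, f.isObj isTwist_zero⟩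

theorem extNonzero_baseChange_iff [IsNoetherianRing A] [Nontrivial A] {ρ : D.U0 →ₐ[K] K} :
    ExtNonzero p ((Algebra.ofId K A).comp ρ) l m ↔ ExtNonzero p ρ l m := by
  obtain ⟨f⟩ := nonempty_twistIso_baseChange_babyVerma (A := A) (p := p) (ρ := ρ) rfl l
  obtain ⟨g⟩ := nonempty_twistIso_baseChange_babyVerma (A := A) (p := p) (ρ := ρ) rfl m
  have key (hl : (babyVerma p ρ l).IsObj ρ) (hm : (babyVerma p ρ m).IsObj ρ) :
      ExtNonzero p ((Algebra.ofId K A).comp ρ) l m ↔ ExtNonzero p ρ l m :=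
    (f.nonsplitExt_iff g isTwist_zero).symm.trans (PreObj.nonsplitExt_baseChange_iff hl hm)
  refine ⟨fun h => ?_, fun h => (key h.isObj.1 h.isObj.2).2 h⟩
  exact (key (isObj_babyVerma_baseChange_iff.1 h.isObj.1)
    (isObj_babyVerma_baseChange_iff.1 h.isObj.2)).1 h

variable (D) in
/-- The augmentation `U⁰ → K`, which vanishes on `𝔥`. -/
noncomputable def augmentation : D.U0 →ₐ[K] K := UniversalEnvelopingAlgebra.lift K 0

theorem exists_isTwist_augmentation (hπ : ∀ (α : D.X) (hα : α ∈ D.R) (hα' : -α ∈ D.R),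
      π (UniversalEnvelopingAlgebra.ι K ⟨⁅D.e α, D.e (-α)⁆, D.lie_e_mem_h hα hα'⟩) = 0) :
    ∃ ε, D.IsTwist ε ((Algebra.ofId K A).comp D.augmentation) π := by
  obtain ⟨ε, hε, hεh⟩ := D.exists_isTwistForm_extension
    (π.toLinearMap ∘ₗ (UniversalEnvelopingAlgebra.ι K : D.h →ₗ⁅K⁆ D.U0).toLinearMap) hπ
  refine ⟨ε, hε, fun x => ?_⟩
  have haug : D.augmentation (UniversalEnvelopingAlgebra.ι K x) = 0 :=
    UniversalEnvelopingAlgebra.lift_ι_apply K 0 x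
  rw [AlgHom.comp_apply, haug, map_zero, zero_add, hεh]
  rfl

theorem sameBlock_iff_augmentation [IsNoetherianRing A] [Nontrivial A]
    (hπ : ∀ (α : D.X) (hα : α ∈ D.R) (hα' : -α ∈ D.R),
      π (UniversalEnvelopingAlgebra.ι K ⟨⁅D.e α, D.e (-α)⁆, D.lie_e_mem_h hα hα'⟩) = 0) :
    SameBlock p π l m ↔ SameBlock p D.augmentation l m := by
  obtain ⟨ε, hε⟩ := exists_isTwist_augmentation hπ
  have hrel (l m : D.X) : (HomNonzero p π l m ∨ ExtNonzero p π l m) ↔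
      (HomNonzero p D.augmentation l m ∨ ExtNonzero p D.augmentation l m) := by
    rw [← hε.homNonzero_iff, ← hε.extNonzero_iff, homNonzero_baseChange_iff,
      extNonzero_baseChange_iff]
  simp only [SameBlock, hrel]

end Blocks

end LeviDatum

theorem mainTheorem6_general {K : Type u} [Field K] {p n : ℕ} {D : LeviDatum K n}
    {A B : Type*} [CommRing A] [IsNoetherianRing A] [Nontrivial A] [Algebra K A]
    [CommRing B] [IsNoetherianRing B] [Nontrivial B] [Algebra K B]
    {π : D.U0 →ₐ[K] A} {ρ : D.U0 →ₐ[K] B}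
    (hπ : ∀ (α : D.X) (hα : α ∈ D.R) (hα' : -α ∈ D.R),
      π (UniversalEnvelopingAlgebra.ι K ⟨⁅D.e α, D.e (-α)⁆, D.lie_e_mem_h hα hα'⟩) = 0)
    (hρ : ∀ (α : D.X) (hα : α ∈ D.R) (hα' : -α ∈ D.R),
      ρ (UniversalEnvelopingAlgebra.ι K ⟨⁅D.e α, D.e (-α)⁆, D.lie_e_mem_h hα hα'⟩) = 0)
    (l m : D.X) : LeviDatum.SameBlock p π l m ↔ LeviDatum.SameBlock p ρ l m :=
  (LeviDatum.sameBlock_iff_augmentation hπ).trans (LeviDatum.sameBlock_iff_augmentation hρ).symm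

theorem mainTheorem6 {K : Type u} [Field K] [IsAlgClosed K] (p : ℕ) [Fact p.Prime] [CharP K p]
    {n : ℕ} (D : LeviDatum K n)
    {A : Type v} [CommRing A] [IsLocalRing A] [IsNoetherianRing A] [Algebra K A]
    (π : D.U0 →ₐ[K] A)
    (hπ : ∀ (α : D.X) (hα : α ∈ D.R) (hα' : -α ∈ D.R),
      π (UniversalEnvelopingAlgebra.ι K ⟨⁅D.e α, D.e (-α)⁆, D.lie_e_mem_h hα hα'⟩) = 0)
    (l m : D.X) :
    LeviDatum.SameBlock p π l m ↔ LeviDatum.SameBlock p (LeviDatum.residueMap π) l m := by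
  refine mainTheorem6_general hπ (fun α hα hα' => ?_) l m
  rw [LeviDatum.residueMap, AlgHom.comp_apply, hπ α hα hα', map_zero]
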